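/- Identify the Euclidean plane with $\mathbb{C}$ and let $x=(p,X)$, $y=(q,Y)$ be two unit tangent vectors, i.e. $p,q\in\mathbb{C}$, $|X|=|Y|=1$. A bounded curvature path from $x$ to $y$ is a $C^1$ and piecewise $C^2$ path $\gamma:[0,s]\to\mathbb{C}$, $s>0$, parametrized by arc length, with $\gamma(0)=p$, $\gamma'(0)=X$, $\gamma(s)=q$, $\gamma'(s)=Y$, and $|\gamma''(t)|\le 1$ wherever $\gamma''(t)$ exists; $s$ is its length. Let $c_l(x)=p+iX$, $c_r(x)=p-iX$ be the centres of the two unit circles tangent to $x$, and similarly $c_l(y),c_r(y)$. Assume that $q$ lies in the forward region of $x$: $\langle X,q-p\rangle>0$, $|q-c_l(x)|\ge 1$ and $|q-c_r(x)|\ge 1$. Assume that $x,y$ carries a region $\Omega$. That is: $|c_l(x)-c_l(y)|<4$ and $|c_r(x)-c_r(y)|<4$; there are a path from $x$ to $y$ that is a concatenation of three arcs of unit circles turning left, right, left, and a path from $x$ to $y$ that is a concatenation of three arcs of unit circles turning right, left, right, all six arcs having length in $(0,\pi)$; these two paths together form a simple closed curve (each is injective, and they meet only at $p$ and $q$); and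 $\Omega$ is the closure of the bounded component of the complement of that curve. Let $\Delta(\Omega)$ be the set of embedded (injective) bounded curvature paths from $x$ to $y$ with image in $\Omega$. Then: 1. The paths in $\Delta(\Omega)$ have bounded length: there is $L$ such that every $\gamma\in\Delta(\Omega)$ has length at most $L$. 2. There is $L$ such that every bounded curvature path $\gamma:[0,s]\to\mathbb{C}$ from $x$ to $y$ (embedded or not) of length $s>L$ leaves $\Omega$ (i.e. $\gamma(t)\notin\Omega$ for some $t$), or has diameter $\max_{t_1,t_2}|\gamma(t_1)-\gamma(t_2)|>4$, or has parallel tangents, i.e. there are $t_1<t_2$ in $[0,s]$ with $\gamma'(t_2)=-\gamma'(t_1)$. -/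

import Mathlib

/-- A unit tangent vector of the Euclidean plane (modelled by `ℂ`): a base point and a unit vector.
An endpoint condition is a pair of these. -/
structure UnitTangent where
  base : ℂ
  dir : ℂ
  norm_dir : ‖dir‖ = 1

namespace UnitTangent

/-- Centre of the adjacent unit circle tangent to `u` on its left. -/
noncomputable def leftCenter (u : UnitTangent) : ℂ := u.base + Complex.I * u.dir

/-- Centre of the adjacent unit circle tangent to `u` on its right. -/
noncomputable def rightCenter (u : UnitTangent) : ℂ := u.base - Complex.I * u.dir

/-- The tangent vector reached from `u` after moving at unit speed for time `t` along the adjacent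
unit circle of `u` to the left (`ε = 1`, counterclockwise) or to the right (`ε = -1`, clockwise). -/
noncomputable def turn (u : UnitTangent) (ε : ℤˣ) (t : ℝ) : UnitTangent where
  base := (u.base + (ε : ℤ) * (Complex.I * u.dir)) -
    (ε : ℤ) * (Complex.I * u.dir) * Complex.exp (((((ε : ℤ) : ℝ) * t : ℝ) : ℂ) * Complex.I)
  dir := u.dir * Complex.exp (((((ε : ℤ) : ℝ) * t : ℝ) : ℂ) * Complex.I)
  norm_dir := by rw [norm_mul, u.norm_dir, Complex.norm_exp_ofReal_mul_I, one_mul]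

/-- The arc length parametrized concatenation, from `u`, of three arcs of unit circles of lengths
`a 0`, `a 1`, `a 2` and of alternating orientations `ε`, `-ε`, `ε`. -/
noncomputable def threeArcs (u : UnitTangent) (ε : ℤˣ) (a : Fin 3 → ℝ) (t : ℝ) : UnitTangent :=
  if t ≤ a 0 then u.turn ε t
  else if t ≤ a 0 + a 1 then (u.turn ε (a 0)).turn (-ε) (t - a 0)
  else ((u.turn ε (a 0)).turn (-ε) (a 1)).turn ε (t - a 0 - a 1)

/-- The set of points on the path `threeArcs u ε a`. -/
noncomputable def threeArcsTrace (u : UnitTangent) (ε : ℤˣ) (a : Fin 3 → ℝ) : Set ℂ :=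
  (fun t => (u.threeArcs ε a t).base) '' Set.Icc 0 (a 0 + a 1 + a 2)

/-- `threeArcs u ε a` is an injective path from `u` to `v` formed by three nontrivial arcs,
each of length less than `π`. -/
structure IsThreeArcPath (u v : UnitTangent) (ε : ℤˣ) (a : Fin 3 → ℝ) : Prop where
  pos : ∀ i, 0 < a i
  lt_pi : ∀ i, a i < Real.pi
  endpoint : u.threeArcs ε a (a 0 + a 1 + a 2) = v
  injOn : Set.InjOn (fun t => (u.threeArcs ε a t).base) (Set.Icc 0 (a 0 + a 1 + a 2))

/-- The forward region of `x`: the open half plane in front of `x`, minus the interiors of the two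
disks bounded by the adjacent circles of `x`. -/
def forwardRegion (x : UnitTangent) : Set ℂ :=
  {p | 0 < inner ℝ x.dir (p - x.base) ∧
    1 ≤ dist p x.leftCenter ∧ 1 ≤ dist p x.rightCenter}

end UnitTangent

/-- The union of the bounded connected components of the complement of `C`
(if `C` is a simple closed curve, there is exactly one). -/
def boundedComplement (C : Set ℂ) : Set ℂ :=
  {z | z ∈ Cᶜ ∧ Bornology.IsBounded (connectedComponentIn Cᶜ z)}

/-- The endpoint condition `x, y` carries the region `Ω`: corresponding adjacent circles have
centres at distance less than `4`, and there are a left-right-left and a right-left-right path from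
`x` to `y` which meet only at their endpoints, so that their six arcs form a simple closed curve;
`Ω` is the closure of the bounded component of the complement of this curve. -/
def CarriesRegion (x y : UnitTangent) (Ω : Set ℂ) : Prop :=
  dist x.leftCenter y.leftCenter < 4 ∧ dist x.rightCenter y.rightCenter < 4 ∧
  ∃ a b : Fin 3 → ℝ, x.IsThreeArcPath y 1 a ∧ x.IsThreeArcPath y (-1) b ∧
    x.threeArcsTrace 1 a ∩ x.threeArcsTrace (-1) b = {x.base, y.base} ∧
    Ω = closure (boundedComplement (x.threeArcsTrace 1 a ∪ x.threeArcsTrace (-1) b))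

/-- The velocity of a path defined on `[0, s]` (one-sided at the ends). -/
noncomputable def velocity (s : ℝ) (γ : ℝ → ℂ) (t : ℝ) : ℂ := derivWithin γ (Set.Icc 0 s) t

/-- `γ`, restricted to `[0, s]`, is a bounded curvature path (maximal curvature `1`) from `x`
to `y`. Its length is `s`. -/
structure IsBoundedCurvaturePath (x y : UnitTangent) (s : ℝ) (γ : ℝ → ℂ) : Prop where
  pos : 0 < s
  c1 : ContDiffOn ℝ 1 γ (Set.Icc 0 s)
  piecewise_c2 : ∃ (n : ℕ) (p : ℕ → ℝ), p 0 = 0 ∧ p n = s ∧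
    ∀ i < n, p i < p (i + 1) ∧ ContDiffOn ℝ 2 γ (Set.Icc (p i) (p (i + 1)))
  unit_speed : ∀ t ∈ Set.Icc 0 s, ‖velocity s γ t‖ = 1
  start_base : γ 0 = x.base
  start_dir : velocity s γ 0 = x.dir
  end_base : γ s = y.base
  end_dir : velocity s γ s = y.dir
  curvature : ∀ t ∈ Set.Icc 0 s, DifferentiableWithinAt ℝ (velocity s γ) (Set.Icc 0 s) t →
    ‖derivWithin (velocity s γ) (Set.Icc 0 s) t‖ ≤ 1

/-- The space `Δ(Ω)` of embedded bounded curvature paths from `x` to `y` in `Ω`; a path is given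
by its length and its arc length parametrization. -/
def embeddedPathsIn (x y : UnitTangent) (Ω : Set ℂ) : Set (ℝ × (ℝ → ℂ)) :=
  {P | IsBoundedCurvaturePath x y P.1 P.2 ∧ Set.InjOn P.2 (Set.Icc 0 P.1) ∧
    ∀ t ∈ Set.Icc 0 P.1, P.2 t ∈ Ω}

/-- The path has tangent vectors pointing in opposite directions at two parameters. -/
def HasParallelTangents (s : ℝ) (γ : ℝ → ℂ) : Prop :=
  ∃ t₁ ∈ Set.Icc 0 s, ∃ t₂ ∈ Set.Icc 0 s, t₁ < t₂ ∧ velocity s γ t₂ = -velocity s γ t₁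

open Complex in
/-- A unit speed plane curve whose velocity `exp (θ I)` is `1`-Lipschitz, with a continuous
angle function `θ`. -/
structure IsLiftedCurve (Γ : ℝ → ℂ) (θ : ℝ → ℝ) : Prop where
  hasDerivAt : ∀ t, HasDerivAt Γ (exp (θ t * I)) t
  cont : Continuous θ
  lip : ∀ t t', ‖exp (θ t * I) - exp (θ t' * I)‖ ≤ |t - t'|

theorem le_of_quadratic_defect {g : ℝ → ℝ} {a b C : ℝ} (hab : a ≤ b) (hC : 0 ≤ C)
    (hg : ∀ t t', a ≤ t → t ≤ t' → t' ≤ b → g t - C * (t' - t) ^ 2 ≤ g t') : g a ≤ g b := by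
  by_contra! hlt
  obtain ⟨n, hn⟩ := exists_nat_gt (C * (b - a) ^ 2 / (g a - g b))
  have hpos : 0 < g a - g b := by linarith
  have hn0 : (0 : ℝ) < n := lt_of_le_of_lt (by positivity) hn
  set d := (b - a) / n with hd
  have hnd : n * d = b - a := by rw [hd]; field_simp
  have hd0 : 0 ≤ d := div_nonneg (by linarith) hn0.le
  have key : ∀ k : ℕ, k ≤ n → g a - k * (C * d ^ 2) ≤ g (a + k * d) := by
    intro k
    induction k with
    | zero => intro _; simp
    | succ k ih =>
      intro hk
      have h1 := ih (by omega)
      have hk' : ((k : ℝ) + 1) ≤ n := by exact_mod_cast hk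
      have h2 := hg (a + k * d) (a + (k + 1) * d) (by nlinarith [mul_nonneg k.cast_nonneg hd0])
        (by nlinarith) (by nlinarith)
      have h3 : a + (k + 1) * d - (a + k * d) = d := by ring
      rw [h3] at h2
      push_cast
      linarith
  have h1 := key n le_rfl
  rw [hnd] at h1
  have h2 : n * (C * d ^ 2) * n = C * (b - a) ^ 2 := by rw [← hnd]; ring
  rw [div_lt_iff₀ hpos] at hn
  have h3 : a + (b - a) = b := by ring
  rw [h3] at h1
  nlinarith

namespace IsLiftedCurve

open Complex

variable {Γ : ℝ → ℂ} {θ : ℝ → ℝ}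

theorem conj (h : IsLiftedCurve Γ θ) :
    IsLiftedCurve (fun t => (starRingEnd ℂ) (Γ t)) (fun t => -θ t) := by
  have key : ∀ t, exp (((-θ t : ℝ) : ℂ) * I) = (starRingEnd ℂ) (exp (θ t * I)) := by
    intro t
    rw [← exp_conj]; simp
  refine ⟨fun t => ?_, h.cont.neg, fun t t' => ?_⟩
  · rw [key]
    exact (conjCLE.toContinuousLinearMap.hasFDerivAt (x := Γ t)).comp_hasDerivAt t (h.hasDerivAt t)
  · rw [key, key, ← map_sub, RCLike.norm_conj]
    exact h.lip t t'

theorem hasDerivAt_re (h : IsLiftedCurve Γ θ) (c t : ℝ) :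
    HasDerivAt (fun t => (exp (-c * I) * Γ t).re) (Real.cos (θ t - c)) t := by
  have h1 := (h.hasDerivAt t).const_mul (exp (-c * I))
  refine ((reCLM.hasFDerivAt (x := exp (-c * I) * Γ t)).comp_hasDerivAt t h1).congr_deriv ?_
  rw [← exp_add, show (-c * I + θ t * I : ℂ) = ((θ t - c : ℝ) : ℂ) * I by push_cast; ring,
    reCLM_apply, exp_ofReal_mul_I_re]

theorem hasDerivAt_im (h : IsLiftedCurve Γ θ) (c t : ℝ) :
    HasDerivAt (fun t => (exp (-c * I) * Γ t).im) (Real.sin (θ t - c)) t := by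
  have h1 := (h.hasDerivAt t).const_mul (exp (-c * I))
  refine ((imCLM.hasFDerivAt (x := exp (-c * I) * Γ t)).comp_hasDerivAt t h1).congr_deriv ?_
  rw [← exp_add, show (-c * I + θ t * I : ℂ) = ((θ t - c : ℝ) : ℂ) * I by push_cast; ring,
    imCLM_apply, exp_ofReal_mul_I_im]

theorem sq_chord_le (h : IsLiftedCurve Γ θ) (c t t' : ℝ) :
    (Real.cos (θ t - c) - Real.cos (θ t' - c)) ^ 2 +
      (Real.sin (θ t - c) - Real.sin (θ t' - c)) ^ 2 ≤ (t - t') ^ 2 := by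
  have h1 := h.lip t t'
  have h2 : ‖exp (((θ t - c : ℝ) : ℂ) * I) - exp (((θ t' - c : ℝ) : ℂ) * I)‖ ≤ |t - t'| := by
    have : exp (((θ t - c : ℝ) : ℂ) * I) - exp (((θ t' - c : ℝ) : ℂ) * I) =
        exp (((-c : ℝ) : ℂ) * I) * (exp (θ t * I) - exp (θ t' * I)) := by
      rw [mul_sub, ← exp_add, ← exp_add]
      push_cast
      ring_nf
    rw [this, norm_mul, norm_exp_ofReal_mul_I, one_mul]
    exact h1
  have h3 := pow_le_pow_left₀ (norm_nonneg _) h2 2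
  rw [sq_abs, ← normSq_eq_norm_sq, normSq_apply] at h3
  simp only [sub_re, sub_im, exp_ofReal_mul_I_re, exp_ofReal_mul_I_im] at h3
  nlinarith

theorem abs_cos_sub_le (h : IsLiftedCurve Γ θ) (c t t' : ℝ) :
    |Real.cos (θ t - c) - Real.cos (θ t' - c)| ≤ |t - t'| :=
  sq_le_sq.1 (by
    have := h.sq_chord_le c t t'
    nlinarith [sq_nonneg (Real.sin (θ t - c) - Real.sin (θ t' - c))])

theorem abs_sin_sub_le (h : IsLiftedCurve Γ θ) (c t t' : ℝ) :
    |Real.sin (θ t - c) - Real.sin (θ t' - c)| ≤ |t - t'| :=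
  sq_le_sq.1 (by
    have := h.sq_chord_le c t t'
    nlinarith [sq_nonneg (Real.cos (θ t - c) - Real.cos (θ t' - c))])

theorem sin_mul_sub_sq_le (h : IsLiftedCurve Γ θ) (c : ℝ) {t t' : ℝ} (htt : t ≤ t') :
    Real.sin (θ t - c) * (t' - t) - (t' - t) ^ 2 ≤
      (exp (-c * I) * Γ t').im - (exp (-c * I) * Γ t).im := by
  have h1 : ∀ u ∈ Set.Icc t t', HasDerivWithinAt
      (fun u => (exp (-c * I) * Γ u).im - Real.sin (θ t - c) * u)
      (Real.sin (θ u - c) - Real.sin (θ t - c) * 1) (Set.Icc t t') u := fun u _ =>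
    ((h.hasDerivAt_im c u).sub ((hasDerivAt_id u).const_mul _)).hasDerivWithinAt
  have h2 := (convex_Icc t t').norm_image_sub_le_of_norm_hasDerivWithin_le (C := t' - t) h1
    (fun u hu => by
      rw [mul_one, Real.norm_eq_abs]
      refine (h.abs_sin_sub_le c u t).trans ?_
      rw [abs_of_nonneg (by linarith [hu.1])]; linarith [hu.2])
    (Set.left_mem_Icc.2 htt) (Set.right_mem_Icc.2 htt)
  rw [Real.norm_eq_abs, Real.norm_eq_abs, abs_of_nonneg (sub_nonneg.2 htt)] at h2
  have := (abs_le.1 h2).1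
  nlinarith

/-- Turning costs height: where the angle stays in a half circle, the curve advances in the
orthogonal direction at least as much as a unit circle with the same change of angle. -/
theorem abs_cos_sub_cos_le (h : IsLiftedCurve Γ θ) (c : ℝ) {a b : ℝ} (hab : a ≤ b)
    (hs : ∀ t ∈ Set.Icc a b, 0 ≤ Real.sin (θ t - c)) :
    |Real.cos (θ b - c) - Real.cos (θ a - c)| ≤
      (exp (-c * I) * Γ b).im - (exp (-c * I) * Γ a).im := by
  have chord : ∀ t t', a ≤ t → t ≤ t' → t' ≤ b →
      |Real.cos (θ t' - c) - Real.cos (θ t - c)| ≤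
        Real.sin (θ t - c) * (t' - t) + (t' - t) ^ 2 := by
    intro t t' h1 h2 h3
    have hs0 := hs t ⟨h1, h2.trans h3⟩
    have hq := h.sq_chord_le c t' t
    have hy := abs_le.1 (abs_cos_sub_le h c t' t)
    have hS := Real.sin_sq_add_cos_sq (θ t - c)
    have hS' := Real.sin_sq_add_cos_sq (θ t' - c)
    set C := Real.cos (θ t - c)
    set S := Real.sin (θ t - c)
    set C' := Real.cos (θ t' - c)
    set S' := Real.sin (θ t' - c)
    have hτ : 0 ≤ t' - t := by linarith
    set τ := t' - t
    have hC1 : -1 ≤ C ∧ C ≤ 1 := ⟨by nlinarith, by nlinarith⟩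
    set y := C * (S' - S) - S * (C' - C) with hy'
    set n := C * (C' - C) + S * (S' - S) with hn'
    have hn : 2 * n = -((C' - C) ^ 2 + (S' - S) ^ 2) := by rw [hn']; nlinarith
    have hyn : y ^ 2 + n ^ 2 = (C' - C) ^ 2 + (S' - S) ^ 2 := by
      rw [hy', hn']
      linear_combination ((C' - C) ^ 2 + (S' - S) ^ 2) * hS
    have hyτ : |y| ≤ τ := abs_le_of_sq_le_sq (by nlinarith [sq_nonneg n]) hτ
    have hnτ : |n| ≤ τ ^ 2 := by
      rw [abs_le]; constructor <;> nlinarith [sq_nonneg (C' - C), sq_nonneg (S' - S)]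
    have hd : C' - C = C * n - S * y := by
      rw [hy', hn']; linear_combination -(C' - C) * hS
    rw [hd]
    calc |C * n - S * y| ≤ |C * n| + |S * y| := abs_sub _ _
      _ = |C| * |n| + S * |y| := by rw [abs_mul, abs_mul, abs_of_nonneg hs0]
      _ ≤ 1 * τ ^ 2 + S * τ := by
          gcongr
          exact abs_le.2 hC1
      _ = S * τ + τ ^ 2 := by ring
  rw [abs_le]
  constructor
  · have := le_of_quadratic_defect (g := fun t => (exp (-c * I) * Γ t).im + Real.cos (θ t - c))
      hab (C := 2) (by norm_num) (fun t t' h1 h2 h3 => by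
        have := (abs_le.1 (chord t t' h1 h2 h3)).1
        have := h.sin_mul_sub_sq_le c h2
        linarith)
    linarith
  · have := le_of_quadratic_defect (g := fun t => (exp (-c * I) * Γ t).im - Real.cos (θ t - c))
      hab (C := 2) (by norm_num) (fun t t' h1 h2 h3 => by
        have := (abs_le.1 (chord t t' h1 h2 h3)).2
        have := h.sin_mul_sub_sq_le c h2
        linarith)
    linarith

end IsLiftedCurve

namespace IsLiftedCurve

open Complex

variable {Γ : ℝ → ℂ} {θ : ℝ → ℝ}

theorem mul_sub_le_re (h : IsLiftedCurve Γ θ) (c : ℝ) {a b C : ℝ} (hab : a ≤ b)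
    (hC : ∀ t ∈ Set.Icc a b, C ≤ Real.cos (θ t - c)) :
    C * (b - a) ≤ (exp (-c * I) * Γ b).re - (exp (-c * I) * Γ a).re :=
  (convex_Icc a b).mul_sub_le_image_sub_of_le_deriv
    (fun t _ => (h.hasDerivAt_re c t).continuousAt.continuousWithinAt)
    (fun t _ => (h.hasDerivAt_re c t).differentiableAt.differentiableWithinAt)
    (fun t ht => by
      rw [(h.hasDerivAt_re c t).deriv]
      exact hC t (interior_subset ht))
    a (Set.left_mem_Icc.2 hab) b (Set.right_mem_Icc.2 hab) hab

theorem mul_sub_le_im (h : IsLiftedCurve Γ θ) (c : ℝ) {a b C : ℝ} (hab : a ≤ b)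
    (hC : ∀ t ∈ Set.Icc a b, C ≤ Real.sin (θ t - c)) :
    C * (b - a) ≤ (exp (-c * I) * Γ b).im - (exp (-c * I) * Γ a).im :=
  (convex_Icc a b).mul_sub_le_image_sub_of_le_deriv
    (fun t _ => (h.hasDerivAt_im c t).continuousAt.continuousWithinAt)
    (fun t _ => (h.hasDerivAt_im c t).differentiableAt.differentiableWithinAt)
    (fun t ht => by
      rw [(h.hasDerivAt_im c t).deriv]
      exact hC t (interior_subset ht))
    a (Set.left_mem_Icc.2 hab) b (Set.right_mem_Icc.2 hab) hab

theorem im_sub_im_le (Γ : ℝ → ℂ) (c a b : ℝ) :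
    (exp (-c * I) * Γ b).im - (exp (-c * I) * Γ a).im ≤ ‖Γ b - Γ a‖ := by
  rw [← sub_im, ← mul_sub]
  refine (im_le_norm _).trans ?_
  rw [norm_mul, show (-c * I : ℂ) = ((-c : ℝ) : ℂ) * I by push_cast; ring,
    norm_exp_ofReal_mul_I, one_mul]

theorem re_sub_re_le (Γ : ℝ → ℂ) (c a b : ℝ) :
    (exp (-c * I) * Γ b).re - (exp (-c * I) * Γ a).re ≤ ‖Γ b - Γ a‖ := by
  rw [← sub_re, ← mul_sub]
  refine (re_le_norm _).trans ?_
  rw [norm_mul, show (-c * I : ℂ) = ((-c : ℝ) : ℂ) * I by push_cast; ring,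
    norm_exp_ofReal_mul_I, one_mul]

/-- A curve that runs almost orthogonally to the direction `c` for a time `6` moves by more
than `4`, if its orthogonal velocity starts with positive sign. -/
theorem four_lt_norm_of_cos_lt (h : IsLiftedCurve Γ θ) (c : ℝ) {a : ℝ}
    (hcos : ∀ t ∈ Set.Icc a (a + 6), 0 ≤ Real.cos (θ t - c))
    (hlt : ∀ t ∈ Set.Icc a (a + 6), Real.cos (θ t - c) < 3 / 5)
    (ha : 0 ≤ Real.sin (θ a - c)) : 4 < ‖Γ (a + 6) - Γ a‖ := by
  have hsq : ∀ t ∈ Set.Icc a (a + 6), 16 / 25 < Real.sin (θ t - c) ^ 2 := by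
    intro t ht
    have := Real.sin_sq_add_cos_sq (θ t - c)
    nlinarith [hcos t ht, hlt t ht]
  have hpos : ∀ t ∈ Set.Icc a (a + 6), 4 / 5 ≤ Real.sin (θ t - c) := by
    intro t ht
    have h0 : 0 ≤ Real.sin (θ t - c) := by
      by_contra! hneg
      have hc : ContinuousOn (fun t => Real.sin (θ t - c)) (Set.Icc a t) :=
        (Real.continuous_sin.comp (h.cont.sub continuous_const)).continuousOn
      obtain ⟨u, hu, hu0⟩ := intermediate_value_Icc' ht.1 hc ⟨hneg.le, ha⟩
      have := hsq u ⟨hu.1, hu.2.trans ht.2⟩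
      dsimp only at hu0
      rw [hu0] at this
      norm_num at this
    nlinarith [hsq t ht]
  have h1 := h.mul_sub_le_im c (by linarith : a ≤ a + 6) hpos
  have h2 := im_sub_im_le Γ c a (a + 6)
  linarith

theorem re_add_le_of_cos_nonneg (h : IsLiftedCurve Γ θ) (c : ℝ) {a : ℝ}
    (hcos : ∀ t ∈ Set.Icc a (a + 6), 0 ≤ Real.cos (θ t - c))
    (hdist : ‖Γ (a + 6) - Γ a‖ ≤ 4) :
    (exp (-c * I) * Γ a).re + 9 / 100 ≤ (exp (-c * I) * Γ (a + 6)).re := by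
  have hmono : ∀ u v, a ≤ u → u ≤ v → v ≤ a + 6 →
      (exp (-c * I) * Γ u).re ≤ (exp (-c * I) * Γ v).re := by
    intro u v h1 h2 h3
    have := h.mul_sub_le_re c h2 (C := 0) fun t ht => hcos t ⟨h1.trans ht.1, ht.2.trans h3⟩
    linarith
  by_cases hex : ∃ t ∈ Set.Icc a (a + 6), 3 / 5 ≤ Real.cos (θ t - c)
  · obtain ⟨t, ht, htc⟩ := hex
    obtain ⟨u, hu1, hu2, hu3, hu4⟩ : ∃ u, a ≤ u ∧ u + 3 / 10 ≤ a + 6 ∧ u ≤ t ∧ t ≤ u + 3 / 10 := by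
      by_cases hc : t + 3 / 10 ≤ a + 6
      · exact ⟨t, ht.1, hc, le_rfl, by linarith⟩
      · exact ⟨t - 3 / 10, by linarith, by linarith [ht.2], by linarith, by linarith⟩
    have h1 := h.mul_sub_le_re c (by linarith : u ≤ u + 3 / 10) (C := 3 / 10) fun w hw => by
      have h2 := (abs_le.1 (h.abs_cos_sub_le c w t)).1
      have h3 : |w - t| ≤ 3 / 10 := abs_le.2 ⟨by linarith [hw.1], by linarith [hw.2]⟩
      linarith
    have h2 := hmono a u le_rfl hu1 (by linarith)
    have h3 := hmono (u + 3 / 10) (a + 6) (by linarith) hu2 le_rfl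
    linarith
  · push Not at hex
    exfalso
    rcases le_total 0 (Real.sin (θ a - c)) with h0 | h0
    · exact absurd (h.four_lt_norm_of_cos_lt c hcos hex h0) (not_lt.2 hdist)
    · have hneg : ∀ t, -θ t - -c = -(θ t - c) := fun t => by ring
      have := h.conj.four_lt_norm_of_cos_lt (-c) (a := a)
        (fun t ht => by rw [hneg, Real.cos_neg]; exact hcos t ht)
        (fun t ht => by rw [hneg, Real.cos_neg]; exact hex t ht)
        (by rw [hneg, Real.sin_neg]; linarith)
      rw [← map_sub, RCLike.norm_conj] at this
      exact absurd this (not_lt.2 hdist)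

theorem sub_le_of_cos_nonneg (h : IsLiftedCurve Γ θ) (c : ℝ) {a b : ℝ}
    (hcos : ∀ t ∈ Set.Icc a b, 0 ≤ Real.cos (θ t - c))
    (hdist : ∀ t ∈ Set.Icc a b, ∀ t' ∈ Set.Icc a b, ‖Γ t' - Γ t‖ ≤ 4) : b - a ≤ 270 := by
  by_contra! hlt
  have key : ∀ k : ℕ, k ≤ 45 →
      (exp (-c * I) * Γ a).re + k * (9 / 100) ≤ (exp (-c * I) * Γ (a + k * 6)).re := by
    intro k
    induction k with
    | zero => intro _; simp
    | succ k ih =>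
      intro hk
      have hk' : (k : ℝ) + 1 ≤ 45 := by exact_mod_cast hk
      have hk0 : (0 : ℝ) ≤ k := k.cast_nonneg
      have h1 := h.re_add_le_of_cos_nonneg c (a := a + k * 6)
        (fun t ht => hcos t ⟨by linarith [ht.1], by linarith [ht.2]⟩)
        (hdist _ ⟨by linarith, by linarith⟩ _ ⟨by linarith, by linarith⟩)
      have h2 := ih (by omega)
      have h3 : a + k * 6 + 6 = a + ((k + 1 : ℕ) : ℝ) * 6 := by push_cast; ring
      rw [h3] at h1
      refine le_trans ?_ h1
      push_cast
      linarith
  have h1 := key 45 le_rfl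
  have h2 := re_sub_re_le Γ c a (a + (45 : ℕ) * 6)
  have h3 := hdist a ⟨le_rfl, by linarith⟩ (a + (45 : ℕ) * 6)
    ⟨by norm_num, by push_cast; linarith⟩
  have h4 : ((45 : ℕ) : ℝ) * (9 / 100) = 81 / 20 := by norm_num
  rw [h4] at h1
  generalize a + ((45 : ℕ) : ℝ) * 6 = e at h1 h2 h3
  generalize (exp (-c * I) * Γ e).re = X at h1 h2
  linarith

/-- A unit speed curve of curvature at most `1` that stays in a disk of diameter `4` turns by `π`
on every interval of length more than `270`. -/
theorem exists_turn_pi (h : IsLiftedCurve Γ θ) {a b : ℝ} (hab : 270 < b - a)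
    (hdist : ∀ t ∈ Set.Icc a b, ∀ t' ∈ Set.Icc a b, ‖Γ t' - Γ t‖ ≤ 4) :
    ∃ t ∈ Set.Icc a b, ∃ t' ∈ Set.Icc a b, t < t' ∧
      (θ t' = θ t + Real.pi ∨ θ t' = θ t - Real.pi) := by
  have hne : (Set.Icc a b).Nonempty := ⟨a, le_rfl, by linarith⟩
  obtain ⟨u, hu, humin⟩ := isCompact_Icc.exists_isMinOn hne h.cont.continuousOn
  obtain ⟨w, hw, hwmax⟩ := isCompact_Icc.exists_isMaxOn hne h.cont.continuousOn
  by_cases hr : θ w - θ u ≤ Real.pi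
  · have := h.sub_le_of_cos_nonneg ((θ u + θ w) / 2) (a := a) (b := b) (fun t ht => by
      have h1 : θ u ≤ θ t := humin ht
      have h2 : θ t ≤ θ w := hwmax ht
      exact Real.cos_nonneg_of_mem_Icc ⟨by linarith, by linarith⟩) hdist
    linarith
  · push Not at hr
    have hpi := Real.pi_pos
    rcases le_total u w with huw | huw
    · obtain ⟨t', ht', htt⟩ := intermediate_value_Icc huw (h.cont.continuousOn (s := Set.Icc u w))
        (show θ u + Real.pi ∈ Set.Icc (θ u) (θ w) from ⟨by linarith, by linarith⟩)
      refine ⟨u, hu, t', ⟨hu.1.trans ht'.1, ht'.2.trans hw.2⟩, lt_of_le_of_ne ht'.1 ?_, .inl htt⟩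
      rintro rfl; linarith
    · obtain ⟨t', ht', htt⟩ := intermediate_value_Icc' huw (h.cont.continuousOn (s := Set.Icc w u))
        (show θ w - Real.pi ∈ Set.Icc (θ u) (θ w) from ⟨by linarith, by linarith⟩)
      refine ⟨w, hw, t', ⟨hw.1.trans ht'.1, ht'.2.trans hu.2⟩, lt_of_le_of_ne ht'.1 ?_, .inr htt⟩
      rintro rfl; linarith

/-- A curve that turns left by `ω` and then right by `ω` does not fit into a disk of radius less
than `1 - cos ω`. -/
theorem lt_of_turn_back (h : IsLiftedCurve Γ θ) {ω r : ℝ} {O : ℂ} (hω0 : 0 < ω)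
    (hω : ω ≤ Real.pi) (hr : r < 1 - Real.cos ω) {t₁ t₂ t₃ : ℝ} (h12 : t₁ ≤ t₂) (h23 : t₂ ≤ t₃)
    (hball : ∀ t ∈ Set.Icc t₁ t₃, ‖Γ t - O‖ ≤ r) (h1 : θ t₁ ≤ θ t₂ - ω) : θ t₂ - ω < θ t₃ := by
  by_contra! h3
  obtain ⟨m, hm, hmax⟩ := isCompact_Icc.exists_isMaxOn (s := Set.Icc t₁ t₃)
    ⟨t₁, le_rfl, h12.trans h23⟩ h.cont.continuousOn
  have hm2 : θ t₂ ≤ θ m := hmax ⟨h12, h23⟩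
  set c := θ m - ω with hc
  have hclosed : IsClosed {t | θ t = c} := isClosed_eq h.cont continuous_const
  obtain ⟨a, ⟨ha, hac⟩, hamax⟩ := (isCompact_Icc.inter_right hclosed).exists_isGreatest (by
    obtain ⟨a, ha, hac⟩ := intermediate_value_Icc hm.1 (h.cont.continuousOn (s := Set.Icc t₁ m))
      (show c ∈ Set.Icc (θ t₁) (θ m) from ⟨by linarith, by linarith⟩)
    exact ⟨a, ha, hac⟩ : (Set.Icc t₁ m ∩ {t | θ t = c}).Nonempty)
  obtain ⟨b, ⟨hb, hbc⟩, hbmin⟩ := (isCompact_Icc.inter_right hclosed).exists_isLeast (by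
    obtain ⟨a, ha, hac⟩ := intermediate_value_Icc' hm.2 (h.cont.continuousOn (s := Set.Icc m t₃))
      (show c ∈ Set.Icc (θ t₃) (θ m) from ⟨by linarith, by linarith⟩)
    exact ⟨a, ha, hac⟩ : (Set.Icc m t₃ ∩ {t | θ t = c}).Nonempty)
  have hac' : θ a = c := hac
  have hbc' : θ b = c := hbc
  have hleft : ∀ t ∈ Set.Icc a m, c ≤ θ t := by
    intro t ht
    by_contra! hlt
    obtain ⟨u, hu, huc⟩ := intermediate_value_Icc ht.2 (h.cont.continuousOn (s := Set.Icc t m))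
      (show c ∈ Set.Icc (θ t) (θ m) from ⟨hlt.le, by linarith⟩)
    have h4 : u ≤ a := hamax ⟨⟨ha.1.trans (ht.1.trans hu.1), hu.2⟩, huc⟩
    have h5 : t = a := le_antisymm (hu.1.trans h4) ht.1
    rw [h5] at hlt; linarith
  have hright : ∀ t ∈ Set.Icc m b, c ≤ θ t := by
    intro t ht
    by_contra! hlt
    obtain ⟨u, hu, huc⟩ := intermediate_value_Icc' ht.1 (h.cont.continuousOn (s := Set.Icc m t))
      (show c ∈ Set.Icc (θ t) (θ m) from ⟨hlt.le, by linarith⟩)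
    have h4 : b ≤ u := hbmin ⟨⟨hu.1, hu.2.trans (ht.2.trans hb.2)⟩, huc⟩
    have h5 : t = b := le_antisymm ht.2 (h4.trans hu.2)
    rw [h5] at hlt; linarith
  have hsin : ∀ t ∈ Set.Icc t₁ t₃, c ≤ θ t → 0 ≤ Real.sin (θ t - c) := fun t ht hct => by
    have : θ t ≤ θ m := hmax ht
    exact Real.sin_nonneg_of_nonneg_of_le_pi (by linarith) (by linarith)
  have hA := h.abs_cos_sub_cos_le c ha.2 fun t ht =>
    hsin t ⟨ha.1.trans ht.1, ht.2.trans hm.2⟩ (hleft t ht)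
  have hB := h.abs_cos_sub_cos_le c hb.1 fun t ht =>
    hsin t ⟨hm.1.trans ht.1, ht.2.trans hb.2⟩ (hright t ht)
  have hmc : θ m - c = ω := by rw [hc]; ring
  rw [hac', sub_self, Real.cos_zero, hmc] at hA
  rw [hbc', sub_self, Real.cos_zero, hmc] at hB
  have h5 := im_sub_im_le Γ c a b
  have h6 : ‖Γ b - Γ a‖ ≤ r + r := by
    rw [show Γ b - Γ a = (Γ b - O) - (Γ a - O) by ring]
    exact (norm_sub_le _ _).trans (add_le_add (hball b ⟨hm.1.trans hb.1, hb.2⟩)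
      (hball a ⟨ha.1, ha.2.trans hm.2⟩))
  have h7 := (abs_le.1 hA).1
  have h8 := (abs_le.1 hB).2
  linarith

end IsLiftedCurve

/-- If no turn of `θ` by `ω < π` is undone by a turn back, while `θ` varies by `π` on all intervals
of length `T`, then successive increases by `π` add up. -/
theorem exists_drift {θ : ℝ → ℝ} {s T ω P : ℝ} (hT : 0 ≤ T) (hω : ω ≤ P)
    (hwin : ∀ a, 0 ≤ a → a + T ≤ s → ∃ t ∈ Set.Icc a (a + T), ∃ t' ∈ Set.Icc a (a + T), t < t' ∧
      (θ t' = θ t + P ∨ θ t' = θ t - P))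
    (hpeak : ∀ t₁ t₂ t₃, 0 ≤ t₁ → t₁ ≤ t₂ → t₂ ≤ t₃ → t₃ ≤ s → θ t₁ ≤ θ t₂ - ω → θ t₂ - ω < θ t₃)
    {t₀ t₀' : ℝ} (ht₀ : t₀ ∈ Set.Icc 0 T) (ht₀' : t₀' ∈ Set.Icc 0 T) (hlt : t₀ < t₀')
    (hup : θ t₀' = θ t₀ + P) (k : ℕ) (hk : (k + 1) * T ≤ s) :
    ∃ t ∈ Set.Icc (k * T) ((k + 1) * T), ∃ t' ∈ Set.Icc (k * T) ((k + 1) * T), t < t' ∧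
      θ t' = θ t + P ∧ θ t₀ + k * (P - ω) ≤ θ t := by
  induction k with
  | zero => exact ⟨t₀, by simpa using ht₀, t₀', by simpa using ht₀', hlt, hup, by simp⟩
  | succ k ih =>
    push_cast at hk ⊢
    have hk0 : (0 : ℝ) ≤ k := k.cast_nonneg
    obtain ⟨t, ht, t', ht', htt, hPt, hge⟩ := ih (by nlinarith)
    obtain ⟨u, hu, u', hu', huu, hor⟩ := hwin ((k + 1) * T) (by positivity) (by linarith)
    have ht0 : 0 ≤ t := le_trans (by positivity) ht.1
    have hus : u' ≤ s := hu'.2.trans (by linarith)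
    have h1 : θ t' - ω < θ u := hpeak t t' u ht0 htt.le (ht'.2.trans hu.1) (by linarith)
      (by linarith)
    refine ⟨u, ⟨hu.1, by linarith [hu.2]⟩, u', ⟨hu'.1, by linarith [hu'.2]⟩, huu, ?_, by linarith⟩
    rcases hor with hor | hor
    · exact hor
    · have h2 : θ t' - ω < θ u' := hpeak t t' u' ht0 htt.le (ht'.2.trans hu'.1) hus (by linarith)
      have h3 := hpeak t u u' ht0 (htt.le.trans (ht'.2.trans hu.1)) huu.le hus (by linarith)
      linarith

theorem bounded_of_no_turn_back {θ : ℝ → ℝ} {s T ω P K : ℝ} (hT : 0 < T) (hω : ω < P)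
    (hωpos : 0 < ω)
    (hwin : ∀ a, 0 ≤ a → a + T ≤ s → ∃ t ∈ Set.Icc a (a + T), ∃ t' ∈ Set.Icc a (a + T), t < t' ∧
      (θ t' = θ t + P ∨ θ t' = θ t - P))
    (hpeak : ∀ t₁ t₂ t₃, 0 ≤ t₁ → t₁ ≤ t₂ → t₂ ≤ t₃ → t₃ ≤ s → θ t₁ ≤ θ t₂ - ω → θ t₂ - ω < θ t₃)
    (hvalley : ∀ t₁ t₂ t₃, 0 ≤ t₁ → t₁ ≤ t₂ → t₂ ≤ t₃ → t₃ ≤ s → θ t₂ + ω ≤ θ t₁ →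
      θ t₃ < θ t₂ + ω)
    (hK : |θ s - θ 0| ≤ K) : s ≤ ((2 * K + 2 * P) / (P - ω) + 2) * T := by
  by_contra! hlt
  obtain ⟨hK1, hK2⟩ := abs_le.1 hK
  have hPω : 0 < P - ω := by linarith
  have hK0 : 0 ≤ K := (abs_nonneg _).trans hK
  set Q := (2 * K + 2 * P) / (P - ω) with hQ
  have hQ0 : 0 ≤ Q := div_nonneg (by linarith) hPω.le
  have hs0 : T ≤ s := by nlinarith
  have hrange : ∀ t, 0 ≤ t → t ≤ s → |θ t - θ 0| < K + P := by
    intro t h0 hs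
    rw [abs_lt]
    constructor
    · by_contra! hc
      have := hvalley 0 t s le_rfl h0 hs le_rfl (by linarith)
      linarith
    · by_contra! hc
      have := hpeak 0 t s le_rfl h0 hs le_rfl (by linarith)
      linarith
  have hN := Nat.lt_floor_add_one Q
  have hN' := Nat.floor_le hQ0
  set n := ⌊Q⌋₊
  have hkT : (((n + 1 : ℕ) : ℝ) + 1) * T ≤ s := by push_cast; nlinarith
  have hfin : 2 * K + 2 * P < ((n + 1 : ℕ) : ℝ) * (P - ω) := by
    push_cast
    rwa [← div_lt_iff₀ hPω]
  have hnn : (0 : ℝ) ≤ ((n + 1 : ℕ) : ℝ) := Nat.cast_nonneg _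
  obtain ⟨t, ht, t', ht', htt, hor⟩ := hwin 0 le_rfl (by linarith)
  rw [zero_add] at ht ht'
  have h1 := abs_lt.1 (hrange t ht.1 (ht.2.trans hs0))
  rcases hor with hor | hor
  · obtain ⟨u, hu, -, -, -, -, hu3⟩ := exists_drift hT.le hω.le hwin hpeak ht ht' htt hor (n + 1) hkT
    have h2 := abs_lt.1 (hrange u ((mul_nonneg hnn hT.le).trans hu.1) (hu.2.trans hkT))
    linarith
  · obtain ⟨u, hu, -, -, -, -, hu3⟩ := exists_drift (θ := fun t => -θ t) hT.le hω.le
      (fun a h0 hs => by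
        obtain ⟨t, ht, t', ht', htt, hor⟩ := hwin a h0 hs
        refine ⟨t, ht, t', ht', htt, ?_⟩
        rcases hor with hor | hor
        · right; rw [hor]; ring
        · left; rw [hor]; ring)
      (fun t₁ t₂ t₃ a1 a2 a3 a4 a5 => by
        have := hvalley t₁ t₂ t₃ a1 a2 a3 a4 (by linarith)
        linarith)
      ht ht' htt (by rw [hor]; ring) (n + 1) hkT
    have h2 := abs_lt.1 (hrange u ((mul_nonneg hnn hT.le).trans hu.1) (hu.2.trans hkT))
    linarith

/-- The unit complex number with argument `t`. -/
noncomputable def cis (t : ℝ) : ℂ := Complex.exp (t * Complex.I)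

theorem cis_re (t : ℝ) : (cis t).re = Real.cos t := Complex.exp_ofReal_mul_I_re t

theorem cis_im (t : ℝ) : (cis t).im = Real.sin t := Complex.exp_ofReal_mul_I_im t

theorem norm_cis (t : ℝ) : ‖cis t‖ = 1 := Complex.norm_exp_ofReal_mul_I t

theorem cis_add (s t : ℝ) : cis (s + t) = cis s * cis t := by
  rw [cis, cis, cis, ← Complex.exp_add]; push_cast; ring_nf

theorem cis_zero : cis 0 = 1 := by simp [cis]

theorem conj_cis (t : ℝ) : (starRingEnd ℂ) (cis t) = cis (-t) := by
  apply Complex.ext <;> simp [cis_re, cis_im]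

theorem continuous_cis : Continuous cis := by unfold cis; fun_prop

theorem sq_norm_cis_add_cis_sub (a b c : ℝ) :
    ‖cis a + cis b - cis c‖ ^ 2 =
      3 + 2 * Real.cos ((c - a) + (b - c)) - 2 * Real.cos (c - a) - 2 * Real.cos (b - c) := by
  rw [Complex.sq_norm, Complex.normSq_apply, show (c - a) + (b - c) = b - a by ring]
  simp only [Complex.sub_re, Complex.add_re, Complex.sub_im, Complex.add_im, cis_re, cis_im,
    Real.cos_sub]
  linear_combination Real.sin_sq_add_cos_sq a + Real.sin_sq_add_cos_sq b +
    Real.sin_sq_add_cos_sq c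

theorem three_add_two_cos_sub_eq (x y : ℝ) :
    3 + 2 * Real.cos (x + y) - 2 * Real.cos x - 2 * Real.cos y =
      1 + 4 * Real.cos ((x + y) / 2) * (Real.cos ((x + y) / 2) - Real.cos ((x - y) / 2)) := by
  have h1 : Real.cos (x + y) = 2 * Real.cos ((x + y) / 2) ^ 2 - 1 := by
    rw [← Real.cos_two_mul]; ring_nf
  have h2 := Real.cos_add_cos x y
  linear_combination 2 * h1 - 2 * h2

theorem three_add_two_cos_sub_lt_one_iff {x y : ℝ} (hx : 0 < x) (hy : 0 < y) (hx' : x < Real.pi)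
    (hy' : y < Real.pi) :
    3 + 2 * Real.cos (x + y) - 2 * Real.cos x - 2 * Real.cos y < 1 ↔ x + y < Real.pi := by
  rw [three_add_two_cos_sub_eq]
  have h1 : Real.cos ((x + y) / 2) < Real.cos ((x - y) / 2) := by
    rw [← Real.cos_abs ((x - y) / 2)]
    refine Real.cos_lt_cos_of_nonneg_of_le_pi (abs_nonneg _) (by linarith) ?_
    rw [abs_lt]; constructor <;> linarith
  constructor
  · intro h
    by_contra! hc
    have h2 : Real.cos ((x + y) / 2) ≤ 0 :=
      Real.cos_nonpos_of_pi_div_two_le_of_le (by linarith) (by linarith)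
    nlinarith
  · intro h
    have h2 : 0 < Real.cos ((x + y) / 2) := Real.cos_pos_of_mem_Ioo ⟨by linarith, by linarith⟩
    nlinarith

theorem norm_cis_add_cis_sub_lt_one {a b c : ℝ} (hac : a < c) (hcb : c < b)
    (hab : b - a < Real.pi) : ‖cis a + cis b - cis c‖ < 1 := by
  have h := (three_add_two_cos_sub_lt_one_iff (sub_pos.2 hac) (sub_pos.2 hcb) (by linarith)
    (by linarith)).2 (by linarith)
  rw [← sq_norm_cis_add_cis_sub] at h
  nlinarith [norm_nonneg (cis a + cis b - cis c)]

theorem norm_cis_sub_cis_lt_two {a b : ℝ} (h : |a - b| < Real.pi) : ‖cis a - cis b‖ < 2 := by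
  have h1 : ‖cis a - cis b‖ ^ 2 = 2 - 2 * Real.cos (a - b) := by
    rw [Complex.sq_norm, Complex.normSq_apply]
    simp only [Complex.sub_re, Complex.sub_im, cis_re, cis_im, Real.cos_sub]
    linear_combination Real.sin_sq_add_cos_sq a + Real.sin_sq_add_cos_sq b
  have h2 : -1 < Real.cos (a - b) := by
    rw [← Real.cos_abs, ← Real.cos_pi]
    exact Real.cos_lt_cos_of_nonneg_of_le_pi (abs_nonneg _) le_rfl h
  nlinarith [norm_nonneg (cis a - cis b)]

/-- The directions at the ends of the arcs of a left-right-left path (`0`, `α`, `β`, `ψ`) and of a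
right-left-right path (`0`, `γ`, `δ`, `ψ`) from a common start to a common end, when all of them lie
in an interval of length less than `π`. -/
structure BeltAngles (α β γ δ ψ : ℝ) : Prop where
  α_pos : 0 < α
  γ_neg : γ < 0
  β_lt_α : β < α
  γ_lt_δ : γ < δ
  β_lt_ψ : β < ψ
  ψ_lt_δ : ψ < δ
  α_sub_γ : α - γ < Real.pi
  α_sub_β : α - β < Real.pi
  δ_sub_γ : δ - γ < Real.pi
  δ_sub_β : δ - β < Real.pi
  closing : 1 + cis β + cis δ = cis α + cis γ + cis ψ

/-- The points of the normalized left-right-left path with directions `0`, `α`, `β`, `ψ`. -/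
def belt (α β ψ : ℝ) : Set ℂ :=
  (fun t => 1 - cis t) '' Set.Icc 0 α ∪ ((fun t => 1 - 2 * cis α + cis t) '' Set.Icc β α ∪
    (fun t => 1 - 2 * cis α + 2 * cis β - cis t) '' Set.Icc β ψ)

theorem isCompact_belt (α β ψ : ℝ) : IsCompact (belt α β ψ) := by
  have := continuous_cis
  refine .union (isCompact_Icc.image (by fun_prop)) (.union (isCompact_Icc.image (by fun_prop))
    (isCompact_Icc.image (by fun_prop)))

namespace BeltAngles

variable {α β γ δ ψ : ℝ}

theorem norm_sub_lt_two (h : BeltAngles α β γ δ ψ) {w : ℂ} (hw : w ∈ belt α β ψ) :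
    ‖w - (cis γ - cis α)‖ < 2 := by
  obtain ⟨h1, h2, h3, h4, h5, h6, h7, h8, h9, h10, hcl⟩ := h
  rcases hw with ⟨t, ht, rfl⟩ | ⟨t, ht, rfl⟩ | ⟨t, ht, rfl⟩
  · rcases ht.1.eq_or_lt with rfl | ht0
    · dsimp only
      rw [cis_zero, show (1 : ℂ) - 1 - (cis γ - cis α) = cis α - cis γ by ring]
      exact norm_cis_sub_cis_lt_two (by rw [abs_lt]; constructor <;> linarith)
    · have hE := norm_cis_add_cis_sub_lt_one h2 ht0 (by linarith [ht.2])
      rw [cis_zero] at hE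
      calc ‖1 - cis t - (cis γ - cis α)‖ = ‖cis α - (cis γ + cis t - 1)‖ := by ring_nf
        _ ≤ ‖cis α‖ + ‖cis γ + cis t - 1‖ := norm_sub_le _ _
        _ < 2 := by rw [norm_cis]; linarith
  · have hE := norm_cis_add_cis_sub_lt_one h2 h1 h7
    rw [cis_zero] at hE
    calc ‖1 - 2 * cis α + cis t - (cis γ - cis α)‖ = ‖cis t - (cis γ + cis α - 1)‖ := by ring_nf
      _ ≤ ‖cis t‖ + ‖cis γ + cis α - 1‖ := norm_sub_le _ _
      _ < 2 := by rw [norm_cis]; linarith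
  · have hE : (1 : ℂ) - 2 * cis α + 2 * cis β - cis t - (cis γ - cis α) =
        cis β + cis ψ - cis t - cis δ := by linear_combination hcl
    dsimp only
    rw [hE]
    rcases ht.2.eq_or_lt with rfl | htψ
    · rw [add_sub_cancel_right]
      exact norm_cis_sub_cis_lt_two (by rw [abs_lt]; constructor <;> linarith)
    rcases ht.1.eq_or_lt with rfl | htβ
    · rw [add_sub_cancel_left]
      exact norm_cis_sub_cis_lt_two (by rw [abs_lt]; constructor <;> linarith)
    have hE := norm_cis_add_cis_sub_lt_one htβ htψ (by linarith)
    calc ‖cis β + cis ψ - cis t - cis δ‖ ≤ ‖cis β + cis ψ - cis t‖ + ‖cis δ‖ := norm_sub_le _ _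
      _ < 2 := by rw [norm_cis]; linarith

/-- `μ` is a direction in which all the given directions advance. -/
theorem exists_middle (h : BeltAngles α β γ δ ψ) : ∃ μ : ℝ,
    (∀ t, γ ≤ t → t ≤ δ → |t - μ| ≤ Real.pi / 2) ∧ (∀ t, β ≤ t → t ≤ α → |t - μ| ≤ Real.pi / 2) := by
  obtain ⟨h1, h2, h3, h4, h5, h6, h7, h8, h9, h10, hcl⟩ := h
  refine ⟨(min γ β + max α δ) / 2, fun t a b => ?_, fun t a b => ?_⟩ <;>
  · rw [abs_le]
    rcases min_cases γ β with ⟨e1, f1⟩ | ⟨e1, f1⟩ <;> rcases max_cases α δ with ⟨e2, f2⟩ | ⟨e2, f2⟩ <;>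
    · rw [e1, e2]
      constructor <;> linarith

theorem sin_le_sin_of_abs_le {μ s t : ℝ} (hst : s ≤ t) (hs : |s - μ| ≤ Real.pi / 2)
    (ht : |t - μ| ≤ Real.pi / 2) : Real.sin (s - μ) ≤ Real.sin (t - μ) :=
  Real.sin_le_sin_of_le_of_le_pi_div_two (abs_le.1 hs).1 (abs_le.1 ht).2 (by linarith)

theorem re_I_mul_cis_mul (t μ : ℝ) : (Complex.I * cis t * cis (-μ)).re = -Real.sin (t - μ) := by
  rw [mul_assoc, ← cis_add, ← sub_eq_add_neg, Complex.I_mul_re, cis_im]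

theorem re_nonneg (h : BeltAngles α β γ δ ψ) {μ : ℝ}
    (h₁ : ∀ t, γ ≤ t → t ≤ δ → |t - μ| ≤ Real.pi / 2)
    (h₂ : ∀ t, β ≤ t → t ≤ α → |t - μ| ≤ Real.pi / 2)
    (h₀ : |0 - μ| ≤ Real.pi / 2) {w : ℂ} (hw : w ∈ belt α β ψ) :
    0 ≤ (Complex.I * w * cis (-μ)).re ∧
      0 ≤ (Complex.I * (1 - 2 * cis α + 2 * cis β - cis ψ - w) * cis (-μ)).re := by
  have hc0 : (Complex.I * cis (-μ)).re = -Real.sin (0 - μ) := by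
    rw [← re_I_mul_cis_mul, cis_zero, mul_one]
  obtain ⟨h1, h2, h3, h4, h5, h6, h7, h8, h9, h10, hcl⟩ := h
  have hα := h₂ α h3.le le_rfl
  have hβ := h₂ β le_rfl h3.le
  have hψ : |ψ - μ| ≤ Real.pi / 2 := by
    have hδ := abs_le.1 (h₁ δ h4.le le_rfl)
    rw [abs_le]; constructor <;> linarith [(abs_le.1 hβ).1]
  have e0α := sin_le_sin_of_abs_le h1.le h₀ hα
  have eβα := sin_le_sin_of_abs_le h3.le hβ hα
  have eβψ := sin_le_sin_of_abs_le h5.le hβ hψ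
  rcases hw with ⟨t, ht, rfl⟩ | ⟨t, ht, rfl⟩ | ⟨t, ht, rfl⟩
  · have ht' : |t - μ| ≤ Real.pi / 2 := by
      rw [abs_le] at h₀ hα ⊢; constructor <;> linarith [ht.1, ht.2]
    have e1 := sin_le_sin_of_abs_le ht.1 h₀ ht'
    have e2 := sin_le_sin_of_abs_le ht.2 ht' hα
    constructor
    · rw [show Complex.I * (1 - cis t) * cis (-μ) =
        Complex.I * cis (-μ) - Complex.I * cis t * cis (-μ) by ring]
      simp only [Complex.sub_re, hc0, re_I_mul_cis_mul]
      linarith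
    · rw [show Complex.I * (1 - 2 * cis α + 2 * cis β - cis ψ - (1 - cis t)) * cis (-μ) =
        -Complex.I * cis α * cis (-μ) - Complex.I * cis α * cis (-μ) +
          Complex.I * cis β * cis (-μ) + Complex.I * cis β * cis (-μ) -
          Complex.I * cis ψ * cis (-μ) + Complex.I * cis t * cis (-μ) by ring]
      simp only [Complex.sub_re, Complex.add_re, neg_mul, Complex.neg_re, re_I_mul_cis_mul]
      linarith
  · have ht' := h₂ t ht.1 ht.2
    have e1 := sin_le_sin_of_abs_le ht.1 hβ ht'
    have e2 := sin_le_sin_of_abs_le ht.2 ht' hα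
    constructor
    · rw [show Complex.I * (1 - 2 * cis α + cis t) * cis (-μ) =
        Complex.I * cis (-μ) - Complex.I * cis α * cis (-μ) - Complex.I * cis α * cis (-μ) +
          Complex.I * cis t * cis (-μ) by ring]
      simp only [Complex.sub_re, Complex.add_re, hc0, re_I_mul_cis_mul]
      linarith
    · rw [show Complex.I * (1 - 2 * cis α + 2 * cis β - cis ψ - (1 - 2 * cis α + cis t)) *
        cis (-μ) = Complex.I * cis β * cis (-μ) + Complex.I * cis β * cis (-μ) -
          Complex.I * cis ψ * cis (-μ) - Complex.I * cis t * cis (-μ) by ring]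
      simp only [Complex.sub_re, Complex.add_re, re_I_mul_cis_mul]
      linarith
  · have ht' : |t - μ| ≤ Real.pi / 2 := by
      rw [abs_le] at hβ hψ ⊢; constructor <;> linarith [ht.1, ht.2]
    have e1 := sin_le_sin_of_abs_le ht.1 hβ ht'
    have e2 := sin_le_sin_of_abs_le ht.2 ht' hψ
    constructor
    · rw [show Complex.I * (1 - 2 * cis α + 2 * cis β - cis t) * cis (-μ) =
        Complex.I * cis (-μ) - Complex.I * cis α * cis (-μ) - Complex.I * cis α * cis (-μ) +
          Complex.I * cis β * cis (-μ) + Complex.I * cis β * cis (-μ) -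
          Complex.I * cis t * cis (-μ) by ring]
      simp only [Complex.sub_re, Complex.add_re, hc0, re_I_mul_cis_mul]
      linarith
    · rw [show Complex.I * (1 - 2 * cis α + 2 * cis β - cis ψ -
        (1 - 2 * cis α + 2 * cis β - cis t)) * cis (-μ) =
          Complex.I * cis t * cis (-μ) - Complex.I * cis ψ * cis (-μ) by ring]
      simp only [Complex.sub_re, re_I_mul_cis_mul]
      linarith

end BeltAngles

/-- The directions of a left-right-left and a right-left-right path with common ends, all of whose
arcs are shorter than `π`, lie in an open half circle. -/
theorem beltAngles_of_closing {a b : Fin 3 → ℝ} (ha : ∀ i, 0 < a i) (ha' : ∀ i, a i < Real.pi)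
    (hb : ∀ i, 0 < b i) (hb' : ∀ i, b i < Real.pi)
    (hdir : cis (a 0 - a 1 + a 2) = cis (-(b 0 - b 1 + b 2)))
    (hclose : 1 - 2 * cis (a 0) + 2 * cis (a 0 - a 1) - cis (a 0 - a 1 + a 2) =
      -(1 - 2 * cis (-b 0) + 2 * cis (-(b 0 - b 1)) - cis (-(b 0 - b 1 + b 2)))) :
    BeltAngles (a 0) (a 0 - a 1) (-b 0) (-(b 0 - b 1)) (a 0 - a 1 + a 2) := by
  have hpi := Real.pi_pos
  have a0 := ha 0; have a1 := ha 1; have a2 := ha 2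
  have a0' := ha' 0; have a1' := ha' 1; have a2' := ha' 2
  have b0 := hb 0; have b1 := hb 1; have b2 := hb 2
  have b0' := hb' 0; have b1' := hb' 1; have b2' := hb' 2
  have hsum : 1 + cis (a 0 - a 1) + cis (-(b 0 - b 1)) =
      cis (a 0) + cis (-b 0) + cis (a 0 - a 1 + a 2) := by
    rw [← hdir] at hclose
    linear_combination hclose / 2
  have hN0 : ‖cis (-b 0) + cis (a 0) - 1‖ < 1 ↔ a 0 + b 0 < Real.pi := by
    have h1 := sq_norm_cis_add_cis_sub (-b 0) (a 0) 0
    rw [cis_zero, show (0 : ℝ) - -b 0 = b 0 by ring, sub_zero] at h1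
    rw [add_comm (a 0), ← three_add_two_cos_sub_lt_one_iff b0 a0 b0' a0', ← h1]
    exact (sq_lt_one_iff₀ (norm_nonneg _)).symm
  have hN2 : ‖cis (-b 0) + cis (a 0) - 1‖ < 1 ↔ a 2 + b 2 < Real.pi := by
    have h2 : cis (-(b 0 - b 1)) = cis (a 0 - a 1 + a 2 + b 2) := by
      rw [cis_add, hdir, ← cis_add]; ring_nf
    have h4 : cis (a 0 - a 1) + cis (a 0 - a 1 + a 2 + b 2) - cis (a 0 - a 1 + a 2) =
        cis (-b 0) + cis (a 0) - 1 := by rw [← h2]; linear_combination hsum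
    have h3 := sq_norm_cis_add_cis_sub (a 0 - a 1) (a 0 - a 1 + a 2 + b 2) (a 0 - a 1 + a 2)
    rw [h4, show a 0 - a 1 + a 2 - (a 0 - a 1) = a 2 by ring,
      show a 0 - a 1 + a 2 + b 2 - (a 0 - a 1 + a 2) = b 2 by ring] at h3
    rw [← three_add_two_cos_sub_lt_one_iff a2 b2 a2' b2', ← h3]
    exact (sq_lt_one_iff₀ (norm_nonneg _)).symm
  obtain ⟨k, hk⟩ := Complex.exp_eq_exp_iff_exists_int.1 hdir
  have hk' : a 0 - a 1 + a 2 = -(b 0 - b 1 + b 2) + k * (2 * Real.pi) := by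
    have := congrArg Complex.im hk
    simpa using this
  by_cases hlt : a 0 + b 0 < Real.pi
  · have hlt2 : a 2 + b 2 < Real.pi := hN2.1 (hN0.2 hlt)
    have hk0 : k = 0 := by
      have h1 : (k : ℝ) < 1 := by nlinarith
      have h2 : (-1 : ℝ) < k := by nlinarith
      have h1' : k < 1 := by exact_mod_cast h1
      have h2' : -1 < k := by exact_mod_cast h2
      omega
    rw [hk0, Int.cast_zero, zero_mul, add_zero] at hk'
    exact ⟨a0, by linarith, by linarith, by linarith, by linarith, by linarith, by linarith,
      by linarith, by linarith, by linarith, hsum⟩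
  · exfalso
    have hlt2 : ¬ a 2 + b 2 < Real.pi := fun h => hlt (hN0.1 (hN2.2 h))
    push Not at hlt hlt2
    have hk1 : k = 1 := by
      have h1 : (k : ℝ) < 2 := by nlinarith
      have h2 : (0 : ℝ) < k := by
        by_contra! hc
        nlinarith
      have h1' : k < 2 := by exact_mod_cast h1
      have h2' : 0 < k := by exact_mod_cast h2
      omega
    rw [hk1, Int.cast_one, one_mul] at hk'
    set lo := min (a 0 - Real.pi) (-(b 0 - b 1)) with hlo
    set hi := max (Real.pi - b 0) (a 0 - a 1) with hhi
    have hl1 : lo ≤ a 0 - Real.pi := min_le_left _ _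
    have hl2 : lo ≤ -(b 0 - b 1) := min_le_right _ _
    have hr1 : Real.pi - b 0 ≤ hi := le_max_left _ _
    have hr2 : a 0 - a 1 ≤ hi := le_max_right _ _
    have hlh : hi - lo ≤ Real.pi := by
      rcases min_cases (a 0 - Real.pi) (-(b 0 - b 1)) with ⟨e1, f1⟩ | ⟨e1, f1⟩ <;>
      rcases max_cases (Real.pi - b 0) (a 0 - a 1) with ⟨e2, f2⟩ | ⟨e2, f2⟩ <;>
      · rw [hlo, hhi, e1, e2]
        linarith
    set μ := (lo + hi) / 2 with hμ
    have hc : ∀ t, lo ≤ t → t ≤ hi → 0 ≤ Real.cos (t - μ) := fun t h1 h2 =>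
      Real.cos_nonneg_of_mem_Icc ⟨by linarith, by linarith⟩
    have hc0 : 0 < Real.cos (0 - μ) :=
      Real.cos_pos_of_mem_Ioo ⟨by linarith, by linarith⟩
    have hcβ := hc (a 0 - a 1) (by linarith) hr2
    have hcδ := hc (-(b 0 - b 1)) hl2 (by linarith)
    have hcα := hc (a 0 - Real.pi) hl1 (by linarith)
    have hcγ := hc (Real.pi - b 0) (by linarith) hr1
    have hcψ := hc (a 0 - a 1 + a 2 - Real.pi) (by linarith) (by linarith)
    rw [show a 0 - Real.pi - μ = a 0 - μ - Real.pi by ring, Real.cos_sub_pi] at hcα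
    rw [show Real.pi - b 0 - μ = -b 0 - μ + Real.pi by ring, Real.cos_add_pi] at hcγ
    rw [show a 0 - a 1 + a 2 - Real.pi - μ = a 0 - a 1 + a 2 - μ - Real.pi by ring,
      Real.cos_sub_pi] at hcψ
    have hS := congrArg (fun z => (z * cis (-μ)).re) hsum
    simp only [← cis_zero, add_mul, ← cis_add, Complex.add_re, cis_re, ← sub_eq_add_neg] at hS
    linarith

theorem closure_boundedComplement_subset {C K : Set ℂ} (hC : C.Nonempty) (hK : Convex ℝ K)
    (hKc : IsClosed K) (hCK : C ⊆ K) : closure (boundedComplement C) ⊆ K := by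
  refine closure_minimal (fun z hz => ?_) hKc
  by_contra hzK
  obtain ⟨f, u, hf, hu⟩ := geometric_hahn_banach_closed_point hK hKc hzK
  obtain ⟨a, ha⟩ := hC
  have hfa := hf a (hCK ha)
  have hd : 0 < f (z - a) := by rw [map_sub]; linarith
  have hd0 : 0 < ‖z - a‖ := norm_pos_iff.2 fun h => by rw [h, map_zero] at hd; exact lt_irrefl _ hd
  set R : Set ℂ := (fun t : ℝ => z + t • (z - a)) '' Set.Ici 0 with hR
  have hRc : IsPreconnected R := isPreconnected_Ici.image _ (by fun_prop)
  have hRC : R ⊆ Cᶜ := by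
    rintro _ ⟨t, ht, rfl⟩ hmem
    have h1 := hf _ (hCK hmem)
    rw [map_add, map_smul, smul_eq_mul] at h1
    have := mul_nonneg (Set.mem_Ici.1 ht) hd.le
    linarith
  have hzR : z ∈ R := ⟨0, Set.self_mem_Ici, by simp⟩
  obtain ⟨M, hM⟩ := isBounded_iff_forall_norm_le.1
    (hz.2.subset (hRc.subset_connectedComponentIn hzR hRC))
  have hM0 : 0 ≤ M := (norm_nonneg z).trans (hM z hzR)
  have ht0 : 0 ≤ (M + ‖z‖ + 1) / ‖z - a‖ := by positivity
  have h1 := hM _ ⟨(M + ‖z‖ + 1) / ‖z - a‖, ht0, rfl⟩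
  have h2 : ‖((M + ‖z‖ + 1) / ‖z - a‖) • (z - a)‖ = M + ‖z‖ + 1 := by
    rw [norm_smul, Real.norm_of_nonneg ht0, div_mul_cancel₀ _ hd0.ne']
  have h3 := norm_sub_norm_le (((M + ‖z‖ + 1) / ‖z - a‖) • (z - a)) (-z)
  rw [norm_neg, sub_neg_eq_add, add_comm _ z, h2] at h3
  dsimp only at h1
  linarith

theorem exists_lt_forall_le_of_isCompact {S : Set ℂ} (hS : IsCompact S) {f : ℂ → ℝ}
    (hf : Continuous f) {b : ℝ} (h : ∀ w ∈ S, f w < b) : ∃ r < b, ∀ w ∈ S, f w ≤ r := by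
  rcases S.eq_empty_or_nonempty with rfl | hne
  · exact ⟨b - 1, by linarith, by simp⟩
  · obtain ⟨m, hm, hmax⟩ := hS.exists_isMaxOn hne hf.continuousOn
    exact ⟨f m, h m hm, fun w hw => hmax hw⟩

namespace UnitTangent

open Complex

theorem turn_one_base (u : UnitTangent) (t : ℝ) :
    (u.turn 1 t).base = u.base + I * u.dir * (1 - cis t) := by
  simp [turn, cis]; ring

theorem turn_one_dir (u : UnitTangent) (t : ℝ) : (u.turn 1 t).dir = u.dir * cis t := by
  simp [turn, cis]

theorem turn_neg_one_base (u : UnitTangent) (t : ℝ) :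
    (u.turn (-1) t).base = u.base - I * u.dir * (1 - cis (-t)) := by
  simp [turn, cis]; ring

theorem turn_neg_one_dir (u : UnitTangent) (t : ℝ) : (u.turn (-1) t).dir = u.dir * cis (-t) := by
  simp [turn, cis]

theorem threeArcs_sum (u : UnitTangent) (ε : ℤˣ) {a : Fin 3 → ℝ} (ha : ∀ i, 0 < a i) :
    u.threeArcs ε a (a 0 + a 1 + a 2) = ((u.turn ε (a 0)).turn (-ε) (a 1)).turn ε (a 2) := by
  have h1 := ha 1
  have h2 := ha 2
  rw [threeArcs, if_neg (by linarith), if_neg (by linarith)]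
  congr 1
  ring

theorem exists_mem_belt_of_mem_threeArcsTrace_one (u : UnitTangent) {a : Fin 3 → ℝ} {z : ℂ}
    (hz : z ∈ u.threeArcsTrace 1 a) :
    ∃ w ∈ belt (a 0) (a 0 - a 1) (a 0 - a 1 + a 2), z = u.base + I * u.dir * w := by
  obtain ⟨t, ht, rfl⟩ := hz
  dsimp only
  rw [threeArcs]
  split_ifs with h1 h2
  · exact ⟨_, .inl ⟨t, ⟨ht.1, h1⟩, rfl⟩, turn_one_base u t⟩
  · push Not at h1
    refine ⟨_, .inr (.inl ⟨a 0 + -(t - a 0), ⟨by linarith, by linarith⟩, rfl⟩), ?_⟩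
    dsimp only
    rw [turn_neg_one_base, turn_one_base, turn_one_dir, cis_add]
    ring
  · push Not at h1 h2
    refine ⟨_, .inr (.inr ⟨a 0 - a 1 + (t - a 0 - a 1), ⟨by linarith, by linarith [ht.2]⟩, rfl⟩), ?_⟩
    dsimp only
    rw [turn_one_base, turn_neg_one_base, turn_one_base, turn_neg_one_dir, turn_one_dir,
      cis_add (a 0 - a 1), sub_eq_add_neg (a 0), cis_add (a 0)]
    ring

theorem exists_mem_belt_of_mem_threeArcsTrace_neg_one (u : UnitTangent) {a : Fin 3 → ℝ} {z : ℂ}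
    (hz : z ∈ u.threeArcsTrace (-1) a) :
    ∃ w ∈ belt (a 0) (a 0 - a 1) (a 0 - a 1 + a 2),
      z = u.base - I * u.dir * (starRingEnd ℂ) w := by
  obtain ⟨t, ht, rfl⟩ := hz
  dsimp only
  rw [threeArcs, neg_neg]
  split_ifs with h1 h2
  · refine ⟨_, .inl ⟨t, ⟨ht.1, h1⟩, rfl⟩, ?_⟩
    rw [turn_neg_one_base, map_sub, map_one, conj_cis]
  · push Not at h1
    refine ⟨_, .inr (.inl ⟨a 0 + -(t - a 0), ⟨by linarith, by linarith⟩, rfl⟩), ?_⟩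
    simp only [turn_one_base, turn_neg_one_base, turn_neg_one_dir, map_add, map_sub, map_mul,
      map_one, map_ofNat, conj_cis, cis_add, neg_neg]
    ring
  · push Not at h1 h2
    refine ⟨_, .inr (.inr ⟨a 0 - a 1 + (t - a 0 - a 1), ⟨by linarith, by linarith [ht.2]⟩, rfl⟩), ?_⟩
    simp only [turn_one_base, turn_neg_one_base, turn_neg_one_dir, turn_one_dir, map_add, map_sub,
      map_mul, map_one, map_ofNat, conj_cis]
    rw [neg_add (a 0 - a 1), cis_add (-(a 0 - a 1)), neg_sub (a 0), sub_eq_add_neg (a 1),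
      cis_add (a 1)]
    ring

namespace IsThreeArcPath

variable {x y : UnitTangent} {a b : Fin 3 → ℝ}

theorem dir_eq_of_one (h : x.IsThreeArcPath y 1 a) : y.dir = x.dir * cis (a 0 - a 1 + a 2) := by
  rw [← h.endpoint, threeArcs_sum x 1 h.pos, turn_one_dir, turn_neg_one_dir, turn_one_dir, cis_add,
    sub_eq_add_neg, cis_add]
  ring

theorem base_eq_of_one (h : x.IsThreeArcPath y 1 a) :
    y.base = x.base + I * x.dir *
      (1 - 2 * cis (a 0) + 2 * cis (a 0 - a 1) - cis (a 0 - a 1 + a 2)) := by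
  rw [← h.endpoint, threeArcs_sum x 1 h.pos, turn_one_base, turn_neg_one_dir, turn_neg_one_base,
    turn_one_dir, turn_one_base, cis_add, sub_eq_add_neg (a 0), cis_add (a 0)]
  ring

theorem dir_eq_of_neg_one (h : x.IsThreeArcPath y (-1) b) :
    y.dir = x.dir * cis (-(b 0 - b 1 + b 2)) := by
  rw [← h.endpoint, threeArcs_sum x (-1) h.pos, neg_neg, turn_neg_one_dir, turn_one_dir,
    turn_neg_one_dir, show -(b 0 - b 1 + b 2) = -b 0 + (b 1 + -b 2) by ring, cis_add, cis_add]
  ring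

theorem base_eq_of_neg_one (h : x.IsThreeArcPath y (-1) b) :
    y.base = x.base - I * x.dir *
      (1 - 2 * cis (-b 0) + 2 * cis (-(b 0 - b 1)) - cis (-(b 0 - b 1 + b 2))) := by
  rw [← h.endpoint, threeArcs_sum x (-1) h.pos, neg_neg, turn_neg_one_base, turn_one_dir,
    turn_one_base, turn_neg_one_dir, turn_neg_one_base,
    show -(b 0 - b 1 + b 2) = -b 0 + (b 1 + -b 2) by ring,
    show -(b 0 - b 1) = -b 0 + b 1 by ring, cis_add, cis_add, cis_add]
  ring

theorem beltAngles (h : x.IsThreeArcPath y 1 a) (h' : x.IsThreeArcPath y (-1) b) :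
    BeltAngles (a 0) (a 0 - a 1) (-b 0) (-(b 0 - b 1)) (a 0 - a 1 + a 2) ∧
      BeltAngles (b 0) (b 0 - b 1) (-a 0) (-(a 0 - a 1)) (b 0 - b 1 + b 2) := by
  have hx : x.dir ≠ 0 := norm_pos_iff.1 (by rw [x.norm_dir]; exact one_pos)
  have hdir : cis (a 0 - a 1 + a 2) = cis (-(b 0 - b 1 + b 2)) :=
    mul_left_cancel₀ hx (h.dir_eq_of_one.symm.trans h'.dir_eq_of_neg_one)
  have hclose : 1 - 2 * cis (a 0) + 2 * cis (a 0 - a 1) - cis (a 0 - a 1 + a 2) =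
      -(1 - 2 * cis (-b 0) + 2 * cis (-(b 0 - b 1)) - cis (-(b 0 - b 1 + b 2))) := by
    refine mul_left_cancel₀ (mul_ne_zero I_ne_zero hx) ?_
    linear_combination h'.base_eq_of_neg_one - h.base_eq_of_one
  refine ⟨beltAngles_of_closing h.pos h.lt_pi h'.pos h'.lt_pi hdir hclose,
    beltAngles_of_closing h'.pos h'.lt_pi h.pos h.lt_pi ?_ ?_⟩
  · have := congrArg (starRingEnd ℂ) hdir
    rw [conj_cis, conj_cis, neg_neg] at this
    exact this.symm
  · have := congrArg (starRingEnd ℂ) hclose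
    simp only [map_add, map_sub, map_mul, map_neg, map_one, map_ofNat, conj_cis, neg_neg] at this
    linear_combination this

end IsThreeArcPath

end UnitTangent

open Complex in
/-- A region carried by `x`, `y` lies in a disk of diameter less than `4`, and in a strip with `x`
and `y` on its two sides, pointing across the strip. -/
theorem CarriesRegion.exists_confinement {x y : UnitTangent} {Ω : Set ℂ}
    (h : CarriesRegion x y Ω) : ∃ (O : ℂ) (r : ℝ) (e : ℂ), r < 2 ∧ ‖e‖ = 1 ∧
      0 ≤ (x.dir * (starRingEnd ℂ) e).re ∧ 0 ≤ (y.dir * (starRingEnd ℂ) e).re ∧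
      ∀ z ∈ Ω, ‖z - O‖ ≤ r ∧ 0 ≤ ((z - x.base) * (starRingEnd ℂ) e).re ∧
        0 ≤ ((y.base - z) * (starRingEnd ℂ) e).re := by
  obtain ⟨-, -, a, b, ha, hb, -, rfl⟩ := h
  obtain ⟨hA, hB⟩ := ha.beltAngles hb
  obtain ⟨μ, hμ₁, hμ₂⟩ := hA.exists_middle
  have hX : x.dir * (starRingEnd ℂ) x.dir = 1 := by
    rw [mul_conj, normSq_eq_norm_sq, x.norm_dir]; simp
  have hnX : ‖I * x.dir‖ = 1 := by rw [norm_mul, norm_I, x.norm_dir, one_mul]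
  have hce : (starRingEnd ℂ) (x.dir * cis μ) = (starRingEnd ℂ) x.dir * cis (-μ) := by
    rw [map_mul, conj_cis]
  have hα := hA.α_pos
  have hγ := hA.γ_neg
  have h₀ : |0 - μ| ≤ Real.pi / 2 := by
    have h1 := abs_le.1 (hμ₁ (-b 0) le_rfl hA.γ_lt_δ.le)
    have h2 := abs_le.1 (hμ₂ (a 0) hA.β_lt_α.le le_rfl)
    rw [abs_le]; constructor <;> linarith
  have hψ : |a 0 - a 1 + a 2 - μ| ≤ Real.pi / 2 := by
    have h1 := abs_le.1 (hμ₁ (-(b 0 - b 1)) hA.γ_lt_δ.le le_rfl)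
    have h2 := abs_le.1 (hμ₂ (a 0 - a 1) le_rfl hA.β_lt_α.le)
    have h3 := hA.β_lt_ψ
    have h4 := hA.ψ_lt_δ
    rw [abs_le]; constructor <;> linarith
  obtain ⟨r₁, hr₁, hle₁⟩ := exists_lt_forall_le_of_isCompact
    (isCompact_belt (a 0) (a 0 - a 1) (a 0 - a 1 + a 2))
    (f := fun w => ‖w - (cis (-b 0) - cis (a 0))‖) (by fun_prop) fun w => hA.norm_sub_lt_two
  obtain ⟨r₂, hr₂, hle₂⟩ := exists_lt_forall_le_of_isCompact
    (isCompact_belt (b 0) (b 0 - b 1) (b 0 - b 1 + b 2))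
    (f := fun w => ‖w - (cis (-a 0) - cis (b 0))‖) (by fun_prop) fun w => hB.norm_sub_lt_two
  refine ⟨x.base + I * x.dir * (cis (-b 0) - cis (a 0)), max r₁ r₂, x.dir * cis μ,
    max_lt hr₁ hr₂, by rw [norm_mul, x.norm_dir, norm_cis, one_mul], ?_, ?_, ?_⟩
  · rw [hce, ← mul_assoc, hX, one_mul, cis_re, ← zero_sub]
    exact Real.cos_nonneg_of_mem_Icc (abs_le.1 h₀)
  · rw [hce, ha.dir_eq_of_one, show x.dir * cis (a 0 - a 1 + a 2) *
      ((starRingEnd ℂ) x.dir * cis (-μ)) = x.dir * (starRingEnd ℂ) x.dir *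
        (cis (a 0 - a 1 + a 2) * cis (-μ)) by ring, hX, one_mul, ← cis_add, cis_re,
      ← sub_eq_add_neg]
    exact Real.cos_nonneg_of_mem_Icc (abs_le.1 hψ)
  set e := x.dir * cis μ with he
  set O := x.base + I * x.dir * (cis (-b 0) - cis (a 0)) with hO
  let K : Set ℂ := Metric.closedBall O (max r₁ r₂) ∩
    ({z | (x.base * (starRingEnd ℂ) e).re ≤ (z * (starRingEnd ℂ) e).re} ∩
      {z | (z * (starRingEnd ℂ) e).re ≤ (y.base * (starRingEnd ℂ) e).re})
  have hlin : IsLinearMap ℝ fun z : ℂ => (z * (starRingEnd ℂ) e).re :=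
    ⟨fun z w => by rw [add_mul, add_re], fun c z => by rw [smul_mul_assoc, smul_re]⟩
  have hKconv : Convex ℝ K :=
    (convex_closedBall _ _).inter ((convex_halfSpace_ge hlin _).inter (convex_halfSpace_le hlin _))
  have hKclosed : IsClosed K := Metric.isClosed_closedBall.inter
    ((isClosed_le (by fun_prop) (by fun_prop)).inter (isClosed_le (by fun_prop) (by fun_prop)))
  have hsub : x.threeArcsTrace 1 a ∪ x.threeArcsTrace (-1) b ⊆ K := by
    rintro z (hz | hz)
    · obtain ⟨w, hw, rfl⟩ := x.exists_mem_belt_of_mem_threeArcsTrace_one hz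
      obtain ⟨h1, h2⟩ := hA.re_nonneg hμ₁ hμ₂ h₀ hw
      refine ⟨?_, ?_, ?_⟩
      · rw [mem_closedBall_iff_norm, hO, show x.base + I * x.dir * w -
          (x.base + I * x.dir * (cis (-b 0) - cis (a 0))) =
            I * x.dir * (w - (cis (-b 0) - cis (a 0))) by ring, norm_mul, hnX, one_mul]
        exact (hle₁ w hw).trans (le_max_left _ _)
      · have : (x.base + I * x.dir * w) * (starRingEnd ℂ) e =
            x.base * (starRingEnd ℂ) e + I * w * cis (-μ) := by
          rw [hce]; linear_combination I * w * cis (-μ) * hX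
        rw [Set.mem_ofPred_eq, this, add_re]
        linarith
      · have : y.base * (starRingEnd ℂ) e = (x.base + I * x.dir * w) * (starRingEnd ℂ) e +
            I * (1 - 2 * cis (a 0) + 2 * cis (a 0 - a 1) - cis (a 0 - a 1 + a 2) - w) *
              cis (-μ) := by
          rw [hce, ha.base_eq_of_one]
          linear_combination I * (1 - 2 * cis (a 0) + 2 * cis (a 0 - a 1) -
            cis (a 0 - a 1 + a 2) - w) * cis (-μ) * hX
        rw [Set.mem_ofPred_eq, this, add_re]
        linarith
    · obtain ⟨w, hw, rfl⟩ := x.exists_mem_belt_of_mem_threeArcsTrace_neg_one hz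
      obtain ⟨h1, h2⟩ := hB.re_nonneg (μ := -μ)
        (fun t h1 h2 => by
          have := hμ₂ (-t) (by linarith) (by linarith)
          rwa [← abs_neg, show -(t - -μ) = -t - μ by ring])
        (fun t h1 h2 => by
          have := hμ₁ (-t) (by linarith) (by linarith)
          rwa [← abs_neg, show -(t - -μ) = -t - μ by ring])
        (by rwa [← abs_neg, show -(0 - -μ) = 0 - μ by ring]) hw
      refine ⟨?_, ?_, ?_⟩
      · have h3 := (hle₂ w hw).trans (le_max_right r₁ r₂)
        rw [← norm_neg, ← RCLike.norm_conj] at h3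
        simp only [map_neg, map_sub, conj_cis, neg_neg] at h3
        rw [mem_closedBall_iff_norm, hO, show x.base - I * x.dir * (starRingEnd ℂ) w -
          (x.base + I * x.dir * (cis (-b 0) - cis (a 0))) =
            I * x.dir * -((starRingEnd ℂ) w - (cis (a 0) - cis (-b 0))) by ring, norm_mul, hnX,
          one_mul]
        exact h3
      · have h3 : (x.base - I * x.dir * (starRingEnd ℂ) w) * (starRingEnd ℂ) e =
            x.base * (starRingEnd ℂ) e + (starRingEnd ℂ) (I * w * cis (- -μ)) := by
          simp only [map_mul, conj_cis, conj_I, hce, neg_neg]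
          linear_combination -I * (starRingEnd ℂ) w * cis (-μ) * hX
        rw [Set.mem_ofPred_eq, h3, add_re, conj_re]
        linarith
      · have h3 : y.base * (starRingEnd ℂ) e =
            (x.base - I * x.dir * (starRingEnd ℂ) w) * (starRingEnd ℂ) e +
            (starRingEnd ℂ) (I * (1 - 2 * cis (b 0) + 2 * cis (b 0 - b 1) -
              cis (b 0 - b 1 + b 2) - w) * cis (- -μ)) := by
          rw [hb.base_eq_of_neg_one]
          simp only [map_mul, map_add, map_sub, map_one, map_ofNat, conj_cis, conj_I, hce, neg_neg]
          linear_combination -I * (1 - 2 * cis (-b 0) + 2 * cis (-(b 0 - b 1)) -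
              cis (-(b 0 - b 1 + b 2)) - (starRingEnd ℂ) w) * cis (-μ) * hX
        rw [Set.mem_ofPred_eq, h3, add_re, conj_re]
        linarith
  have hne : (x.threeArcsTrace 1 a ∪ x.threeArcsTrace (-1) b).Nonempty := by
    refine ⟨_, .inl ⟨0, ⟨le_rfl, ?_⟩, rfl⟩⟩
    linarith [ha.pos 0, ha.pos 1, ha.pos 2]
  intro z hz
  obtain ⟨h1, h2, h3⟩ := closure_boundedComplement_subset hne hKconv hKclosed hsub hz
  rw [Set.mem_ofPred_eq] at h2 h3
  refine ⟨mem_closedBall_iff_norm.1 h1, ?_, ?_⟩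
  · rw [sub_mul, sub_re]; linarith
  · rw [sub_mul, sub_re]; linarith

theorem exists_continuous_log {A : Type*} [TopologicalSpace A] [SimplyConnectedSpace A]
    [LocallyPathConnectedSpace A] {F : A → ℂ} (hF : Continuous F) (h0 : ∀ a, F a ≠ 0) :
    ∃ L : A → ℂ, Continuous L ∧ ∀ a, Complex.exp (L a) = F a := by
  obtain ⟨a₀⟩ : Nonempty A := inferInstance
  obtain ⟨L, ⟨-, hL⟩, -⟩ := Complex.isCoveringMapOn_exp.existsUnique_continuousMap_lifts
    ⟨F, hF⟩ (a₀ := a₀) (Complex.exp_log (h0 a₀)) h0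
  exact ⟨L, L.continuous, fun a => congrFun hL a⟩

theorem exp_eq_cis_im {z w : ℂ} (h : Complex.exp z = w) (hw : ‖w‖ = 1) : w = cis z.im := by
  rw [← h, Complex.norm_exp, Real.exp_eq_one_iff] at hw
  rw [← h, cis]
  conv_lhs => rw [← Complex.re_add_im z, hw]
  simp

theorem exists_angle {V : ℝ → ℂ} (hV : Continuous V) (h1 : ∀ t, ‖V t‖ = 1) :
    ∃ θ : ℝ → ℝ, Continuous θ ∧ ∀ t, V t = cis (θ t) := by
  obtain ⟨L, hL, hexp⟩ := exists_continuous_log hV fun t => norm_pos_iff.1 (by rw [h1]; exact one_pos)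
  exact ⟨fun t => (L t).im, by fun_prop, fun t => exp_eq_cis_im (hexp t) (h1 t)⟩

theorem abs_sub_le_of_cos_nonneg {φ : ℝ → ℝ} (hφ : Continuous φ) {a b : ℝ}
    (h : ∀ t ∈ Set.uIcc a b, 0 ≤ Real.cos (φ t)) : |φ b - φ a| ≤ 2 * Real.pi := by
  have hpi := Real.pi_pos
  by_contra! hlt
  set m := min (φ a) (φ b) with hm
  set n := ⌈(m - Real.pi) / (2 * Real.pi)⌉ with hn
  have h1 := Int.le_ceil ((m - Real.pi) / (2 * Real.pi))
  have h2 := Int.ceil_lt_add_one ((m - Real.pi) / (2 * Real.pi))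
  rw [← hn] at h1 h2
  rw [div_le_iff₀ (by positivity)] at h1
  rw [← sub_lt_iff_lt_add, lt_div_iff₀ (by positivity)] at h2
  have hmax : max (φ a) (φ b) = m + |φ b - φ a| := by
    rw [abs_sub_comm, hm, ← max_sub_min_eq_abs']; ring
  obtain ⟨t, ht, hte⟩ := intermediate_value_uIcc (hφ.continuousOn (s := Set.uIcc a b))
    (show n * (2 * Real.pi) + Real.pi ∈ Set.uIcc (φ a) (φ b) from
      ⟨by linarith, by rw [show φ a ⊔ φ b = m + |φ b - φ a| from hmax]; linarith⟩)
  have h3 := h t ht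
  rw [hte, Real.cos_int_mul_two_pi_add_pi] at h3
  linarith

/-- The angle of an embedded plane curve whose ends lie on the two sides of a strip containing
the curve changes by a bounded amount. -/
theorem exists_angle_of_injOn {Γ V : ℝ → ℂ} (hV : Continuous V) (hΓ : ∀ t, HasDerivAt Γ (V t) t)
    (hV1 : ∀ t, ‖V t‖ = 1) {s : ℝ} (hs : 0 ≤ s)
    (hVs : ∀ t, V (Set.projIcc 0 s hs t) = V t) (hinj : Set.InjOn Γ (Set.Icc 0 s)) {e : ℂ}
    (he : ‖e‖ = 1) (h₁ : ∀ u ∈ Set.Icc 0 s, 0 ≤ ((Γ u - Γ 0) * (starRingEnd ℂ) e).re)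
    (h₂ : ∀ u ∈ Set.Icc 0 s, 0 ≤ ((Γ s - Γ u) * (starRingEnd ℂ) e).re)
    (hX : 0 ≤ (V 0 * (starRingEnd ℂ) e).re) (hY : 0 ≤ (V s * (starRingEnd ℂ) e).re) :
    ∃ θ : ℝ → ℝ, Continuous θ ∧ (∀ t, V t = cis (θ t)) ∧ |θ s - θ 0| ≤ 4 * Real.pi := by
  set S : ℝ × ℝ → ℂ := fun q => ∫ τ in (0 : ℝ)..1, V (q.1 + (q.2 - q.1) * τ) with hSdef
  have hScont : Continuous S :=
    intervalIntegral.continuous_parametric_intervalIntegral_of_continuous' (by fun_prop) 0 1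
  have hSdiag : ∀ a, S (a, a) = V a := fun a => by simp [hSdef]
  have hSmul : ∀ a b : ℝ, ((b - a : ℝ) : ℂ) * S (a, b) = Γ b - Γ a := fun a b => by
    have h := intervalIntegral.smul_integral_comp_add_mul (a := 0) (b := 1) V (b - a) a
    rw [Complex.real_smul] at h
    rw [hSdef, h, intervalIntegral.integral_eq_sub_of_hasDerivAt (fun t _ => hΓ t)
      (hV.intervalIntegrable _ _)]
    ring_nf
  set c : ℝ → ℝ := fun t => Set.projIcc 0 s hs t with hc
  have hccont : Continuous c := continuous_subtype_val.comp continuous_projIcc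
  have hcmem : ∀ t, c t ∈ Set.Icc 0 s := fun t => Subtype.coe_prop _
  have hcid : ∀ t ∈ Set.Icc 0 s, c t = t := fun t ht => by
    simp only [hc]; rw [Set.projIcc_of_mem hs ht]
  have hS0 : ∀ q : ℝ × ℝ, S (c q.1, c q.2) ≠ 0 := by
    rintro ⟨a, b⟩ h0
    by_cases hab : c a = c b
    · dsimp only at h0
      rw [hab, hSdiag] at h0
      have := hV1 (c b)
      rw [h0, norm_zero] at this
      exact zero_ne_one this
    · have h := hSmul (c a) (c b)
      dsimp only at h0
      rw [h0, mul_zero] at h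
      exact hab (hinj (hcmem a) (hcmem b) (sub_eq_zero.1 h.symm).symm)
  obtain ⟨L, hL, hexp⟩ := exists_continuous_log (A := ℝ × ℝ)
    (F := fun q => S (c q.1, c q.2)) (by fun_prop) hS0
  have hs0 : (0 : ℝ) ∈ Set.Icc 0 s := ⟨le_rfl, hs⟩
  have hss : s ∈ Set.Icc 0 s := ⟨hs, le_rfl⟩
  have hre : ∀ a b, 0 ≤ a → a ≤ b → b ≤ s → (a = b → 0 ≤ (V a * (starRingEnd ℂ) e).re) →
      0 ≤ ((Γ b - Γ a) * (starRingEnd ℂ) e).re → 0 ≤ Real.cos ((L (a, b)).im - e.arg) := by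
    intro a b ha hab hb hd hsec
    have h3 : 0 ≤ (S (a, b) * (starRingEnd ℂ) e).re := by
      rcases hab.eq_or_lt with rfl | hlt
      · rw [hSdiag]; exact hd rfl
      · rw [← hSmul, mul_assoc, Complex.re_ofReal_mul] at hsec
        exact nonneg_of_mul_nonneg_right hsec (sub_pos.2 hlt)
    have h4 := hexp (a, b)
    dsimp only at h4
    rw [hcid a ⟨ha, hab.trans hb⟩, hcid b ⟨ha.trans hab, hb⟩] at h4
    have h5 : (starRingEnd ℂ) e = cis (-e.arg) := by
      rw [← conj_cis]
      congr 1
      have := Complex.norm_mul_exp_arg_mul_I e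
      rw [he, Complex.ofReal_one, one_mul] at this
      exact this.symm
    rw [← h4, h5, Complex.exp_eq_exp_re_mul_sin_add_cos, mul_assoc, ← Complex.ofReal_exp,
      Complex.re_ofReal_mul] at h3
    have h6 := nonneg_of_mul_nonneg_right h3 (Real.exp_pos _)
    rw [← Complex.exp_mul_I] at h6
    change 0 ≤ (cis (L (a, b)).im * cis (-e.arg)).re at h6
    rwa [← cis_add, cis_re, ← sub_eq_add_neg] at h6
  have hleg₁ := abs_sub_le_of_cos_nonneg (φ := fun u => (L (0, u)).im - e.arg) (by fun_prop)
    (a := 0) (b := s) fun u hu => by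
      rw [Set.uIcc_of_le hs] at hu
      exact hre 0 u le_rfl hu.1 hu.2 (fun _ => hX) (h₁ u hu)
  have hleg₂ := abs_sub_le_of_cos_nonneg (φ := fun u => (L (u, s)).im - e.arg) (by fun_prop)
    (a := 0) (b := s) fun u hu => by
      rw [Set.uIcc_of_le hs] at hu
      exact hre u s hu.1 hu.2 le_rfl (fun h => h ▸ hY) (h₂ u hu)
  refine ⟨fun t => (L (t, t)).im, by fun_prop, fun t => ?_, ?_⟩
  · refine exp_eq_cis_im ?_ (hV1 t)
    rw [hexp, hSdiag]
    exact hVs t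
  · rw [abs_le] at hleg₁ hleg₂ ⊢
    constructor <;> linarith [hleg₁.1, hleg₁.2, hleg₂.1, hleg₂.2]

theorem norm_sub_le_of_norm_deriv_le_one {f : ℝ → ℂ} {a b : ℝ} (hc : ContinuousOn f (Set.Icc a b))
    (hd : ∀ u ∈ Set.Ioo a b, DifferentiableAt ℝ f u ∧ ‖deriv f u‖ ≤ 1) {t t' : ℝ} (ha : a ≤ t)
    (htt : t ≤ t') (hb : t' ≤ b) : ‖f t' - f t‖ ≤ t' - t := by
  rcases htt.eq_or_lt with rfl | hlt
  · simp
  set w := f t' - f t with hw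
  obtain ⟨ξ, hξ, hslope⟩ := exists_hasDerivAt_eq_slope (fun u => ((starRingEnd ℂ) w * f u).re)
    (fun u => ((starRingEnd ℂ) w * deriv f u).re) hlt
    (Complex.continuous_re.comp_continuousOn (continuousOn_const.mul
      (hc.mono (Set.Icc_subset_Icc ha hb))))
    (fun u hu => Complex.reCLM.hasFDerivAt.comp_hasDerivAt u
      ((hd u ⟨ha.trans_lt hu.1, hu.2.trans_le hb⟩).1.hasDerivAt.const_mul _))
  have h1 : ((starRingEnd ℂ) w * deriv f ξ).re ≤ ‖w‖ := by
    refine (Complex.re_le_norm _).trans ?_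
    rw [norm_mul, RCLike.norm_conj]
    exact mul_le_of_le_one_right (norm_nonneg _) (hd ξ ⟨ha.trans_lt hξ.1, hξ.2.trans_le hb⟩).2
  have h2 : ((starRingEnd ℂ) w * f t').re - ((starRingEnd ℂ) w * f t).re = ‖w‖ ^ 2 := by
    rw [← Complex.sub_re, ← mul_sub, ← hw, mul_comm, Complex.mul_conj, Complex.normSq_eq_norm_sq,
      Complex.ofReal_re]
  rw [hslope, h2, div_le_iff₀ (sub_pos.2 hlt)] at h1
  by_contra! hc
  nlinarith [norm_nonneg w]

namespace IsBoundedCurvaturePath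

variable {x y : UnitTangent} {s : ℝ} {γ : ℝ → ℂ}

theorem continuousOn_velocity (h : IsBoundedCurvaturePath x y s γ) :
    ContinuousOn (velocity s γ) (Set.Icc 0 s) :=
  h.c1.continuousOn_derivWithin (uniqueDiffOn_Icc h.pos) le_rfl

theorem hasDerivAt (h : IsBoundedCurvaturePath x y s γ) {t : ℝ} (ht : t ∈ Set.Ioo 0 s) :
    HasDerivAt γ (velocity s γ t) t :=
  ((h.c1.differentiableOn one_ne_zero t
    (Set.Ioo_subset_Icc_self ht)).hasDerivWithinAt).hasDerivAt (Icc_mem_nhds ht.1 ht.2)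

theorem differentiableAt_velocity (h : IsBoundedCurvaturePath x y s γ) {a b : ℝ} (ha : 0 ≤ a)
    (hb : b ≤ s) (hγ : ContDiffOn ℝ 2 γ (Set.Icc a b)) {u : ℝ} (hu : u ∈ Set.Ioo a b) :
    DifferentiableAt ℝ (velocity s γ) u ∧ ‖deriv (velocity s γ) u‖ ≤ 1 := by
  have hmem : ∀ w ∈ Set.Ioo a b, Set.Icc 0 s ∈ nhds w := fun w hw =>
    Icc_mem_nhds (ha.trans_lt hw.1) (hw.2.trans_le hb)
  have h1 : ContDiffOn ℝ 1 (deriv γ) (Set.Ioo a b) :=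
    (hγ.mono Set.Ioo_subset_Icc_self).deriv_of_isOpen isOpen_Ioo (by norm_num)
  have h2 : velocity s γ =ᶠ[nhds u] deriv γ := by
    filter_upwards [isOpen_Ioo.mem_nhds hu] with w hw
    exact derivWithin_of_mem_nhds (hmem w hw)
  have h3 : DifferentiableAt ℝ (velocity s γ) u :=
    (((h1.differentiableOn one_ne_zero) u hu).differentiableAt
      (isOpen_Ioo.mem_nhds hu)).congr_of_eventuallyEq h2
  refine ⟨h3, ?_⟩
  rw [← derivWithin_of_mem_nhds (hmem u hu)]
  exact h.curvature u (mem_of_mem_nhds (hmem u hu)) h3.differentiableWithinAt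

theorem norm_velocity_sub_le (h : IsBoundedCurvaturePath x y s γ) {t t' : ℝ} (h0 : 0 ≤ t)
    (htt : t ≤ t') (hs : t' ≤ s) : ‖velocity s γ t' - velocity s γ t‖ ≤ t' - t := by
  obtain ⟨n, p, hp0, hpn, hp⟩ := h.piecewise_c2
  have hnonneg : ∀ i ≤ n, 0 ≤ p i := by
    intro i
    induction i with
    | zero => intro _; rw [hp0]
    | succ i ih => intro hi; exact (ih (by omega)).trans (hp i hi).1.le
  have hle : ∀ k i, i + k = n → p i ≤ s := by
    intro k
    induction k with
    | zero => rintro i hi; rw [← hpn, ← hi, add_zero]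
    | succ k ih => intro i hi; exact (hp i (by omega)).1.le.trans (ih (i + 1) (by omega))
  have key : ∀ i ≤ n, ∀ t t', 0 ≤ t → t ≤ t' → t' ≤ p i →
      ‖velocity s γ t' - velocity s γ t‖ ≤ t' - t := by
    intro i
    induction i with
    | zero =>
      intro _ t t' h0 htt h1
      rw [hp0] at h1
      rw [le_antisymm h1 (h0.trans htt), le_antisymm (htt.trans h1) h0]
      simp
    | succ i ih =>
      intro hi t t' h0 htt h1
      have hi0 := hnonneg i (by omega)
      have his := hle (n - (i + 1)) (i + 1) (by omega)
      have hpiece : ∀ t t', p i ≤ t → t ≤ t' → t' ≤ p (i + 1) →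
          ‖velocity s γ t' - velocity s γ t‖ ≤ t' - t := fun t t' ha hab hb =>
        norm_sub_le_of_norm_deriv_le_one
          (h.continuousOn_velocity.mono (Set.Icc_subset_Icc hi0 his))
          (fun u hu => h.differentiableAt_velocity hi0 his (hp i hi).2 hu) ha hab hb
      rcases le_total t' (p i) with h2 | h2
      · exact ih (by omega) t t' h0 htt h2
      rcases le_total (p i) t with h3 | h3
      · exact hpiece t t' h3 htt h1
      calc ‖velocity s γ t' - velocity s γ t‖
          = ‖(velocity s γ t' - velocity s γ (p i)) + (velocity s γ (p i) - velocity s γ t)‖ := by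
            ring_nf
        _ ≤ (t' - p i) + (p i - t) := (norm_add_le _ _).trans
            (add_le_add (hpiece _ _ le_rfl h2 h1) (ih (by omega) _ _ h0 h3 le_rfl))
        _ = t' - t := by ring
  exact key n le_rfl t t' h0 htt (by rw [hpn]; exact hs)

/-- A bounded curvature path extends to the whole line, with constant velocity outside its domain. -/
theorem exists_extension (h : IsBoundedCurvaturePath x y s γ) : ∃ Γ V : ℝ → ℂ,
    (∀ t, HasDerivAt Γ (V t) t) ∧ (∀ t t', ‖V t - V t'‖ ≤ |t - t'|) ∧ (∀ t, ‖V t‖ = 1) ∧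
    (∀ t, V (Set.projIcc 0 s h.pos.le t) = V t) ∧
    (∀ t ∈ Set.Icc 0 s, Γ t = γ t) ∧ (∀ t ∈ Set.Icc 0 s, V t = velocity s γ t) := by
  set V : ℝ → ℂ := fun t => velocity s γ (Set.projIcc 0 s h.pos.le t) with hV
  have hVeq : ∀ t ∈ Set.Icc 0 s, V t = velocity s γ t := fun t ht => by
    simp only [hV]; rw [Set.projIcc_of_mem h.pos.le ht]
  have hVlip : ∀ t t', t ≤ t' → ‖V t' - V t‖ ≤ t' - t := fun t t' htt => by
    refine (h.norm_velocity_sub_le (Set.projIcc 0 s h.pos.le t).2.1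
      (Set.monotone_projIcc h.pos.le htt) (Set.projIcc 0 s h.pos.le t').2.2).trans ?_
    have h1 := (LipschitzWith.projIcc h.pos.le).dist_le_mul t' t
    rw [Subtype.dist_eq, Real.dist_eq, Real.dist_eq, NNReal.coe_one, one_mul,
      abs_of_nonneg (sub_nonneg.2 htt)] at h1
    exact (le_abs_self _).trans h1
  have hVlip' : ∀ t t', ‖V t - V t'‖ ≤ |t - t'| := fun t t' => by
    rcases le_total t t' with htt | htt
    · rw [norm_sub_rev, abs_sub_comm, abs_of_nonneg (sub_nonneg.2 htt)]
      exact hVlip t t' htt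
    · rw [abs_of_nonneg (sub_nonneg.2 htt)]
      exact hVlip t' t htt
  have hVcont : Continuous V := (LipschitzWith.of_dist_le_mul (K := 1) fun t t' => by
    rw [dist_eq_norm, Real.dist_eq, NNReal.coe_one, one_mul]
    exact hVlip' t t').continuous
  refine ⟨fun t => γ 0 + ∫ u in (0 : ℝ)..t, V u, V, fun t => ?_, hVlip', fun t =>
    h.unit_speed _ (Subtype.coe_prop _), fun t => ?_, fun t ht => ?_, hVeq⟩
  · exact (hVcont.integral_hasStrictDerivAt 0 t).hasDerivAt.const_add _
  · simp only [hV, Set.projIcc_val]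
  · dsimp only
    rw [intervalIntegral.integral_eq_sub_of_hasDerivAt_of_le ht.1
      (h.c1.continuousOn.mono (Set.Icc_subset_Icc_right ht.2))
      (fun u hu => by
        have hu' : u ∈ Set.Ioo 0 s := ⟨hu.1, hu.2.trans_le ht.2⟩
        rw [hVeq u (Set.Ioo_subset_Icc_self hu')]
        exact h.hasDerivAt hu')
      (hVcont.intervalIntegrable _ _)]
    ring

end IsBoundedCurvaturePath

theorem isLiftedCurve_of_eq_cis {Γ V : ℝ → ℂ} {θ : ℝ → ℝ} (hΓ : ∀ t, HasDerivAt Γ (V t) t)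
    (hV : ∀ t t', ‖V t - V t'‖ ≤ |t - t'|) (hθ : Continuous θ) (h : ∀ t, V t = cis (θ t)) :
    IsLiftedCurve Γ θ where
  hasDerivAt t := by have := hΓ t; rwa [h] at this
  cont := hθ
  lip t t' := by have := hV t t'; rwa [h, h] at this

theorem IsBoundedCurvaturePath.diam_or_parallel {x y : UnitTangent} {s : ℝ}
    {γ : ℝ → ℂ} (h : IsBoundedCurvaturePath x y s γ) (hs : 270 < s) :
    4 < Metric.diam (γ '' Set.Icc 0 s) ∨ HasParallelTangents s γ := by
  by_contra! hc
  obtain ⟨hdiam, hpar⟩ := hc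
  obtain ⟨Γ, V, hΓ, hV, hV1, -, hΓγ, hVv⟩ := h.exists_extension
  have hVcont : Continuous V := (LipschitzWith.of_dist_le_mul (K := 1) fun t t' => by
    rw [dist_eq_norm, Real.dist_eq, NNReal.coe_one, one_mul]
    exact hV t t').continuous
  obtain ⟨θ, hθ, hVθ⟩ := exists_angle hVcont hV1
  have hlift := isLiftedCurve_of_eq_cis hΓ hV hθ hVθ
  have hbdd : Bornology.IsBounded (γ '' Set.Icc 0 s) :=
    (isCompact_Icc.image_of_continuousOn h.c1.continuousOn).isBounded
  obtain ⟨t, ht, t', ht', htt, hor⟩ := hlift.exists_turn_pi (a := 0) (b := s) (by linarith)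
    fun t ht t' ht' => by
      rw [hΓγ t ht, hΓγ t' ht', ← dist_eq_norm]
      exact (Metric.dist_le_diam_of_mem hbdd (Set.mem_image_of_mem _ ht')
        (Set.mem_image_of_mem _ ht)).trans hdiam
  refine hpar ⟨t, ht, t', ht', htt, ?_⟩
  have hpi : cis Real.pi = -1 := Complex.exp_pi_mul_I
  rw [← hVv t ht, ← hVv t' ht', hVθ, hVθ]
  rcases hor with hor | hor
  · rw [hor, cis_add, hpi, mul_neg_one]
  · rw [show θ t = θ t' + Real.pi by linarith, cis_add, hpi, mul_neg_one, neg_neg]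

theorem length_le_of_embedded {x y : UnitTangent} {Ω : Set ℂ} {O e : ℂ} {r ω s : ℝ} {γ : ℝ → ℂ}
    (hr : r < 2) (hω0 : 0 < ω) (hω : ω < Real.pi) (hrω : r < 1 - Real.cos ω) (he : ‖e‖ = 1)
    (hx : 0 ≤ (x.dir * (starRingEnd ℂ) e).re) (hy : 0 ≤ (y.dir * (starRingEnd ℂ) e).re)
    (hΩ : ∀ z ∈ Ω, ‖z - O‖ ≤ r ∧ 0 ≤ ((z - x.base) * (starRingEnd ℂ) e).re ∧
      0 ≤ ((y.base - z) * (starRingEnd ℂ) e).re)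
    (h : (s, γ) ∈ embeddedPathsIn x y Ω) :
    s ≤ ((2 * (4 * Real.pi) + 2 * Real.pi) / (Real.pi - ω) + 2) * 271 := by
  obtain ⟨hγ, hinj, hin⟩ := h
  dsimp only at hγ hinj hin
  have h0 : (0 : ℝ) ∈ Set.Icc 0 s := ⟨le_rfl, hγ.pos.le⟩
  have hs : s ∈ Set.Icc 0 s := ⟨hγ.pos.le, le_rfl⟩
  obtain ⟨Γ, V, hΓ, hV, hV1, hVs, hΓγ, hVv⟩ := hγ.exists_extension
  have hVcont : Continuous V := (LipschitzWith.of_dist_le_mul (K := 1) fun t t' => by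
    rw [dist_eq_norm, Real.dist_eq, NNReal.coe_one, one_mul]
    exact hV t t').continuous
  obtain ⟨θ, hθ, hVθ, hturn⟩ := exists_angle_of_injOn hVcont hΓ hV1 hγ.pos.le hVs
    (hinj.congr fun t ht => (hΓγ t ht).symm) he
    (fun u hu => by
      rw [hΓγ u hu, hΓγ 0 h0, hγ.start_base]
      exact (hΩ _ (hin u hu)).2.1)
    (fun u hu => by
      rw [hΓγ u hu, hΓγ s hs, hγ.end_base]
      exact (hΩ _ (hin u hu)).2.2)
    (by rwa [hVv 0 h0, hγ.start_dir]) (by rwa [hVv s hs, hγ.end_dir])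
  have hlift := isLiftedCurve_of_eq_cis hΓ hV hθ hVθ
  have hball : ∀ t, 0 ≤ t → t ≤ s → ‖Γ t - O‖ ≤ r := fun t ht hts => by
    rw [hΓγ t ⟨ht, hts⟩]
    exact (hΩ _ (hin t ⟨ht, hts⟩)).1
  refine bounded_of_no_turn_back (θ := θ) (by norm_num) hω hω0 (fun a ha has => ?_)
    (fun t₁ t₂ t₃ a1 a2 a3 a4 a5 => ?_) (fun t₁ t₂ t₃ a1 a2 a3 a4 a5 => ?_) hturn
  · refine hlift.exists_turn_pi (by linarith) fun t ht t' ht' => ?_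
    have h1 := hball t (ha.trans ht.1) (ht.2.trans has)
    have h2 := hball t' (ha.trans ht'.1) (ht'.2.trans has)
    calc ‖Γ t' - Γ t‖ = ‖(Γ t' - O) - (Γ t - O)‖ := by ring_nf
      _ ≤ r + r := (norm_sub_le _ _).trans (add_le_add h2 h1)
      _ ≤ 4 := by linarith
  · exact hlift.lt_of_turn_back hω0 hω.le hrω a2 a3
      (fun t ht => hball t (a1.trans ht.1) (ht.2.trans a4)) a5
  · have := hlift.conj.lt_of_turn_back (O := (starRingEnd ℂ) O) hω0 hω.le hrω a2 a3
      (fun t ht => by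
        rw [← map_sub, RCLike.norm_conj]
        exact hball t (a1.trans ht.1) (ht.2.trans a4)) (by linarith)
    linarith

theorem mainTheorem4 (x y : UnitTangent) (Ω : Set ℂ)
    (hy : y.base ∈ x.forwardRegion) (hΩ : CarriesRegion x y Ω) :
    (∃ L : ℝ, ∀ (s : ℝ) (γ : ℝ → ℂ), (s, γ) ∈ embeddedPathsIn x y Ω → s ≤ L) ∧
    (∃ L : ℝ, ∀ (s : ℝ) (γ : ℝ → ℂ), IsBoundedCurvaturePath x y s γ → L < s →
      (∃ t ∈ Set.Icc 0 s, γ t ∉ Ω) ∨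
      4 < Metric.diam (γ '' Set.Icc 0 s) ∨
      HasParallelTangents s γ) := by
  refine ⟨?_, 270, fun s γ hγ hs => .inr (hγ.diam_or_parallel hs)⟩
  obtain ⟨O, r, e, hr, he, hX, hY, hconf⟩ := hΩ.exists_confinement
  obtain ⟨ω, hω0, hω, hrω⟩ : ∃ ω, 0 < ω ∧ ω < Real.pi ∧ r < 1 - Real.cos ω := by
    have hc : ContinuousWithinAt (fun ω => 1 - Real.cos ω) (Set.Iio Real.pi) Real.pi := by
      fun_prop
    have h2 : r < 1 - Real.cos Real.pi := by rw [Real.cos_pi]; linarith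
    obtain ⟨ω, h1, h3⟩ := ((hc.eventually (lt_mem_nhds h2)).and
      (Ioo_mem_nhdsLT Real.pi_pos)).exists
    exact ⟨ω, h3.1, h3.2, h1⟩
  exact ⟨_, fun s γ h => length_le_of_embedded hr hω0 hω hrω he hX hY hconf h⟩
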